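/- Let $\Sigma=\bigcup_n\Sigma_n$ be a one-sorted signature. Let $\mathbf{Th}[\Sigma]$ be the category whose objects are the natural numbers $\underline n$ and whose arrows $\underline m\to\underline n$ are the $n$-tuples of $\Sigma$-terms over the variables $x_1,\dots,x_m$; composition, written $\sigma;\tau$ in diagrammatic order, is substitution. It is strict monoidal: $\underline m\otimes\underline n=\underline{m+n}$, and $\sigma\otimes\tau$ juxtaposes the two tuples on disjoint variables. Put $f=\langle f(x_1,\dots,x_n)\rangle:\underline n\to\underline 1$ for $f\in\Sigma_n$, $\nabla_{\underline n}=\langle x_1,\dots,x_n,x_1,\dots,x_n\rangle:\underline n\to\underline{2n}$, and $\gamma=\langle x_2,x_1\rangle:\underline 2\to\underline 2$. Write $(p_0,p_1,h,g)$ for a square of arrows $p_0:P\to X$ (top), $p_1:P\to Y$ (left), $h:X\to Z$ (right), $g:Y\to Z$ (bottom). It is a pullback square if $p_0;h=p_1;g$ and $(P,p_0,p_1)$ is a pullback of $h$ and $g$. The basis $\mathcal B(\Sigma)$ consists of the squares $$R_f=(id_{\underline n},id_{\underline n},f,f),\qquad D_f=\bigl(f,\ \nabla_{\underline n};(id_{\underline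 n}\otimes f),\ \nabla_{\underline 1},\ f\otimes id_{\underline 1}\bigr),\qquad \hat D_f=\bigl(\nabla_{\underline n};(id_{\underline n}\otimes f),\ f,\ f\otimes id_{\underline 1},\ \nabla_{\underline 1}\bigr)$$ for every $n$ and every $f\in\Sigma_n$, together with $$R_\nabla=(id_{\underline 1},id_{\underline 1},\nabla_{\underline 1},\nabla_{\underline 1}),\qquad R_\gamma=(id_{\underline 2},id_{\underline 2},\gamma,\gamma),\qquad D_\nabla=(\nabla_{\underline 1},\nabla_{\underline 1},id_{\underline 1}\otimes\nabla_{\underline 1},\nabla_{\underline 1}\otimes id_{\underline 1}).$$ A square is generated by $\mathcal B(\Sigma)$ if it is obtained from the squares of $\mathcal B(\Sigma)$ and the identity squares $(id,p,p,id)$ and $(p,id,id,p)$, for arbitrary arrows $p$, by finitely many horizontal, vertical and parallel ($\otimes$) compositions. **Theorem.** 1. A square of $\mathbf{Th}[\Sigma]$ is generated by $\mathcal B(\Sigma)$ if and only if it is a pullback square. 2. Equivalently, in terms of tiles: let $\mathcal R_{PB(\Sigma)}$ be the tile system with horizontal and vertical category $\mathbf{Th}[\Sigma]^{op}$ whose basic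 tiles are the squares of $\mathcal B(\Sigma)$ with all arrows reversed; that is, $(p_0,p_1,h,g)$ becomes the tile with top $g$, left side $h$, right side $p_1$ and bottom $p_0$. Its entailed tiles are the horizontal, vertical and parallel composites of basic tiles and identity tiles. Then the tile with top $t$, left side $u$, right side $v$ and bottom $s$ is entailed by $\mathcal R_{PB(\Sigma)}$ if and only if $(s,v,u,t)$ is a cell of the double category of pullbacks $\mathscr P(\mathbf{Th}[\Sigma])$, i.e. a pullback square in $\mathbf{Th}[\Sigma]$. 3. If $\Sigma$ has finitely many operators, then $\mathcal B(\Sigma)$ is finite. -/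

import Mathlib

open CategoryTheory MonoidalCategory Opposite

universe u v

/-! ### The category of substitutions

A one-sorted signature is given by the function symbols of a first-order language `L`: the set
`L.Functions n` contains the operators of arity `n` (relation symbols play no role). -/

/-- The objects of the algebraic theory `Th[L]`: one object `⟨n⟩` for every natural number `n`,
the interface with `n` canonical variables. -/
@[ext]
structure Th (L : FirstOrder.Language.{u, v}) where
  /-- the number of canonical variables -/
  card : ℕ

namespace Th

open FirstOrder Language

variable {L : FirstOrder.Language.{u, v}}

/-- An arrow from `m` to `n` is an `n`-tuple of terms over `m` canonical variables; composition
(in diagrammatic order) is substitution. -/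
instance : CategoryStruct (Th L) where
  Hom m n := Fin n.card → L.Term (Fin m.card)
  id _ := fun i => Term.var i
  comp σ τ := fun i => (τ i).subst σ

theorem hom_ext {m n : Th L} {σ τ : m ⟶ n} (h : ∀ i, σ i = τ i) : σ = τ := funext h

theorem id_apply (m : Th L) (i : Fin m.card) : (𝟙 m : m ⟶ m) i = Term.var i := rfl

theorem comp_apply {m n k : Th L} (σ : m ⟶ n) (τ : n ⟶ k) (i : Fin k.card) :
    (σ ≫ τ) i = (τ i).subst σ := rfl

theorem subst_var {α : Type*} (t : L.Term α) : t.subst Term.var = t := by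
  induction t with
  | var i => rfl
  | func f ts ih => simp only [Term.subst, ih]

theorem subst_subst {α β γ : Type*} (t : L.Term α) (σ : α → L.Term β) (τ : β → L.Term γ) :
    (t.subst σ).subst τ = t.subst (fun a => (σ a).subst τ) := by
  induction t with
  | var i => rfl
  | func f ts ih => simp only [Term.subst, ih]

theorem subst_relabel {α β γ : Type*} (t : L.Term α) (g : α → β) (τ : β → L.Term γ) :
    (t.relabel g).subst τ = t.subst (fun a => τ (g a)) := by
  induction t with
  | var i => rfl
  | func f ts ih => simp only [Term.relabel, Term.subst, ih]

theorem relabel_eq_subst {α β : Type*} (t : L.Term α) (g : α → β) :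
    t.relabel g = t.subst (fun a => Term.var (g a)) := by
  induction t with
  | var i => rfl
  | func f ts ih => simp only [Term.relabel, Term.subst, ih]

instance : Category (Th L) where
  id_comp σ := hom_ext fun i => subst_var (σ i)
  comp_id _ := rfl
  assoc σ τ υ := hom_ext fun i => (subst_subst (υ i) τ σ).symm

/-- The parallel composition `σ ⊗ τ` of `σ : m ⟶ n` and `τ : k ⟶ l`: the terms of `σ` use the
first `m` variables, those of `τ` the last `k` variables. -/
def tensor {m n k l : Th L} (σ : m ⟶ n) (τ : k ⟶ l) :
    (⟨m.card + k.card⟩ : Th L) ⟶ ⟨n.card + l.card⟩ :=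
  Fin.append (fun i => (σ i).relabel (Fin.castAdd k.card))
    (fun j => (τ j).relabel (Fin.natAdd m.card))

/-- The identity substitution between two objects with equally many variables. -/
def castIso (m n : Th L) (h : m.card = n.card) : m ≅ n where
  hom := fun i => Term.var (Fin.cast h.symm i)
  inv := fun i => Term.var (Fin.cast h i)
  hom_inv_id := rfl
  inv_hom_id := rfl

theorem castIso_hom_apply {m n : Th L} (h : m.card = n.card) (i : Fin n.card) :
    (castIso m n h).hom i = Term.var (Fin.cast h.symm i) := rfl

/-- The strict monoidal structure of `Th[L]`: the tensor product adds numbers of variables, and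
the structural isomorphisms are identity substitutions. -/
instance : MonoidalCategoryStruct (Th L) where
  tensorObj m n := ⟨m.card + n.card⟩
  tensorUnit := ⟨0⟩
  tensorHom σ τ := tensor σ τ
  whiskerLeft m _ _ τ := tensor (𝟙 m) τ
  whiskerRight σ n := tensor σ (𝟙 n)
  associator m n k := castIso _ _ (Nat.add_assoc m.card n.card k.card)
  leftUnitor m := castIso _ _ (Nat.zero_add m.card)
  rightUnitor m := castIso _ _ (Nat.add_zero m.card)

theorem tensor_left {m n k l : Th L} (σ : m ⟶ n) (τ : k ⟶ l) (i : Fin n.card) :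
    (σ ⊗ₘ τ) (Fin.castAdd l.card i) = (σ i).relabel (Fin.castAdd k.card) :=
  Fin.append_left (fun i => (σ i).relabel (Fin.castAdd k.card))
    (fun j => (τ j).relabel (Fin.natAdd m.card)) i

theorem tensor_right {m n k l : Th L} (σ : m ⟶ n) (τ : k ⟶ l) (j : Fin l.card) :
    (σ ⊗ₘ τ) (Fin.natAdd n.card j) = (τ j).relabel (Fin.natAdd m.card) :=
  Fin.append_right (fun i => (σ i).relabel (Fin.castAdd k.card))
    (fun j => (τ j).relabel (Fin.natAdd m.card)) j

/-- Two arrows into `n ⊗ l` agree if they agree on the first `n` and on the last `l` entries. -/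
theorem hom_ext_tensor {m n l : Th L} {σ τ : m ⟶ n ⊗ l}
    (h₁ : ∀ i : Fin n.card, σ (Fin.castAdd l.card i) = τ (Fin.castAdd l.card i))
    (h₂ : ∀ j : Fin l.card, σ (Fin.natAdd n.card j) = τ (Fin.natAdd n.card j)) : σ = τ :=
  funext fun i => Fin.addCases h₁ h₂ i


theorem tensor_comp_tensor {m n k m' n' k' : Th L} (σ : m ⟶ n) (σ' : m' ⟶ n') (τ : n ⟶ k)
    (τ' : n' ⟶ k') : (σ ⊗ₘ σ') ≫ (τ ⊗ₘ τ') = (σ ≫ τ) ⊗ₘ (σ' ≫ τ') := by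
  refine hom_ext_tensor (fun i => ?_) (fun j => ?_)
  · rw [tensor_left, comp_apply, comp_apply, tensor_left, subst_relabel, relabel_eq_subst,
      subst_subst]
    simp only [tensor_left, relabel_eq_subst]
  · rw [tensor_right, comp_apply, comp_apply, tensor_right, subst_relabel, relabel_eq_subst,
      subst_subst]
    simp only [tensor_right, relabel_eq_subst]

theorem comp_castIso_apply {m n k : Th L} (σ : m ⟶ n) (h : n.card = k.card) (i : Fin k.card) :
    (σ ≫ (castIso n k h).hom) i = σ (Fin.cast h.symm i) := rfl

theorem castIso_comp_apply {m n k : Th L} (h : m.card = n.card) (σ : n ⟶ k) (i : Fin k.card) :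
    ((castIso m n h).hom ≫ σ) i = (σ i).relabel (Fin.cast h.symm) :=
  (relabel_eq_subst _ _).symm

theorem id_tensor_id (m n : Th L) : 𝟙 m ⊗ₘ 𝟙 n = 𝟙 (m ⊗ n) := by
  refine hom_ext_tensor (fun i => ?_) (fun j => ?_)
  · rw [tensor_left]; rfl
  · rw [tensor_right]; rfl

theorem castIso_tensor_id {m n : Th L} (h : m.card = n.card) (k : Th L) :
    (castIso m n h).hom ⊗ₘ 𝟙 k =
      (castIso (m ⊗ k) (n ⊗ k) (congrArg (· + k.card) h)).hom := by
  refine hom_ext_tensor (fun i => ?_) (fun j => ?_)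
  · rw [tensor_left]; rfl
  · rw [tensor_right, castIso_hom_apply, id_apply, Term.relabel]
    congr 1
    ext
    simp [h]

theorem id_tensor_castIso {m n : Th L} (k : Th L) (h : m.card = n.card) :
    𝟙 k ⊗ₘ (castIso m n h).hom =
      (castIso (k ⊗ m) (k ⊗ n) (congrArg (k.card + ·) h)).hom := by
  refine hom_ext_tensor (fun i => ?_) (fun j => ?_)
  · rw [tensor_left]; rfl
  · rw [tensor_right]; rfl

theorem associator_natural {m₁ m₂ m₃ n₁ n₂ n₃ : Th L} (σ : m₁ ⟶ n₁) (τ : m₂ ⟶ n₂) (υ : m₃ ⟶ n₃) :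
    ((σ ⊗ₘ τ) ⊗ₘ υ) ≫ (α_ n₁ n₂ n₃).hom = (α_ m₁ m₂ m₃).hom ≫ (σ ⊗ₘ (τ ⊗ₘ υ)) := by
  refine hom_ext_tensor (fun i => ?_) (fun j => Fin.addCases (fun j => ?_) (fun j => ?_) j)
  · refine Eq.trans ?_ (castIso_comp_apply _ _ _).symm
    change ((σ ⊗ₘ τ) ⊗ₘ υ) (Fin.castAdd n₃.card (Fin.castAdd n₂.card i)) = _
    rw [tensor_left, tensor_left, tensor_left, Term.relabel_relabel, Term.relabel_relabel]
    rfl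
  · refine Eq.trans ?_ (castIso_comp_apply _ _ _).symm
    change ((σ ⊗ₘ τ) ⊗ₘ υ) (Fin.castAdd n₃.card (Fin.natAdd n₁.card j)) = _
    rw [tensor_left, tensor_right, tensor_right, tensor_left, Term.relabel_relabel,
      Term.relabel_relabel, Term.relabel_relabel]
    rfl
  · refine Eq.trans ?_ (castIso_comp_apply _ _ _).symm
    have h : (((σ ⊗ₘ τ) ⊗ₘ υ) ≫ (α_ n₁ n₂ n₃).hom) (Fin.natAdd n₁.card (Fin.natAdd n₂.card j)) =
        ((σ ⊗ₘ τ) ⊗ₘ υ) (Fin.natAdd (n₁ ⊗ n₂).card j) :=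
      congrArg ((σ ⊗ₘ τ) ⊗ₘ υ) (Fin.ext (Nat.add_assoc _ _ _).symm)
    rw [h, tensor_right, tensor_right, tensor_right, Term.relabel_relabel, Term.relabel_relabel]
    exact congrArg (fun g => (υ j).relabel g) (funext fun x => Fin.ext (Nat.add_assoc _ _ _))

theorem leftUnitor_natural {m n : Th L} (σ : m ⟶ n) :
    (𝟙 (𝟙_ (Th L)) ⊗ₘ σ) ≫ (λ_ n).hom = (λ_ m).hom ≫ σ := by
  refine hom_ext fun i => Eq.trans ?_ (castIso_comp_apply _ _ _).symm
  have h : ((𝟙 (𝟙_ (Th L)) ⊗ₘ σ) ≫ (λ_ n).hom) i =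
      (𝟙 (𝟙_ (Th L)) ⊗ₘ σ) (Fin.natAdd (𝟙_ (Th L)).card i) :=
    congrArg (𝟙 (𝟙_ (Th L)) ⊗ₘ σ) (Fin.ext (Nat.zero_add _).symm)
  rw [h, tensor_right]
  exact congrArg (fun g => (σ i).relabel g) (funext fun x => Fin.ext (Nat.zero_add _))

theorem rightUnitor_natural {m n : Th L} (σ : m ⟶ n) :
    (σ ⊗ₘ 𝟙 (𝟙_ (Th L))) ≫ (ρ_ n).hom = (ρ_ m).hom ≫ σ := by
  refine hom_ext fun i => Eq.trans ?_ (castIso_comp_apply _ _ _).symm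
  change (σ ⊗ₘ 𝟙 (𝟙_ (Th L))) (Fin.castAdd (𝟙_ (Th L)).card i) = _
  rw [tensor_left]
  rfl

instance : MonoidalCategory (Th L) :=
  MonoidalCategory.ofTensorHom
    (id_tensorHom_id := id_tensor_id)
    (id_tensorHom := fun _ _ _ _ => rfl)
    (tensorHom_id := fun _ _ => rfl)
    (tensorHom_comp_tensorHom := fun σ σ' τ τ' => tensor_comp_tensor σ σ' τ τ')
    (associator_naturality := fun σ τ υ => associator_natural σ τ υ)
    (leftUnitor_naturality := fun σ => leftUnitor_natural σ)
    (rightUnitor_naturality := fun σ => rightUnitor_natural σ)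
    (pentagon := by
      intro W X Y Z
      erw [castIso_tensor_id, id_tensor_castIso]
      rfl)
    (triangle := by
      intro X Y
      erw [castIso_tensor_id, id_tensor_castIso]
      rfl)

end Th

/-! ### Tile systems -/

/-- A square of arrows, not required to commute, drawn as
```
  o₀ --t--> o₁
  |         |
  u         v
  ↓         ↓
  o₂ --s--> o₃
``` -/
structure Cell (C : Type u) [Category.{v} C] where
  {o₀ o₁ o₂ o₃ : C}
  /-- the initial configuration (top) -/
  t : o₀ ⟶ o₁
  /-- the trigger (left) -/
  u : o₀ ⟶ o₂
  /-- the effect (right) -/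
  v : o₁ ⟶ o₃
  /-- the final configuration (bottom) -/
  s : o₂ ⟶ o₃

universe w

/-- A tile system whose horizontal category (configurations) and vertical category (observations)
are both the monoidal category `C`: a set of rule names, and a square for every name. -/
structure TileSystem (C : Type u) [Category.{v} C] [MonoidalCategory C] where
  /-- the rule names -/
  Name : Type w
  /-- the basic tile with a given name -/
  rule : Name → Cell C

/-- `R.Entails t u v s`: the flat tile with top `t`, left side `u`, right side `v` and bottom `s`
is a horizontal, vertical and parallel composite of basic tiles of `R` and of identity tiles. -/
inductive TileSystem.Entails {C : Type u} [Category.{v} C] [MonoidalCategory C]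
    (R : TileSystem.{u, v, w} C) :
    ∀ {o₀ o₁ o₂ o₃ : C}, (o₀ ⟶ o₁) → (o₀ ⟶ o₂) → (o₁ ⟶ o₃) → (o₂ ⟶ o₃) → Prop
  | basic (α : R.Name) : R.Entails (R.rule α).t (R.rule α).u (R.rule α).v (R.rule α).s
  | horizontalId {o₀ o₁ : C} (t : o₀ ⟶ o₁) : R.Entails t (𝟙 o₀) (𝟙 o₁) t
  | verticalId {o₀ o₁ : C} (u : o₀ ⟶ o₁) : R.Entails (𝟙 o₀) u u (𝟙 o₁)
  | horizontalComp {a₀ a₁ a₂ b₀ b₁ b₂ : C} {t₀ : a₀ ⟶ a₁} {t₁ : a₁ ⟶ a₂} {u : a₀ ⟶ b₀}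
      {v : a₁ ⟶ b₁} {w : a₂ ⟶ b₂} {s₀ : b₀ ⟶ b₁} {s₁ : b₁ ⟶ b₂} :
      R.Entails t₀ u v s₀ → R.Entails t₁ v w s₁ → R.Entails (t₀ ≫ t₁) u w (s₀ ≫ s₁)
  | verticalComp {a₀ a₁ b₀ b₁ c₀ c₁ : C} {t : a₀ ⟶ a₁} {u₀ : a₀ ⟶ b₀} {v₀ : a₁ ⟶ b₁}
      {s : b₀ ⟶ b₁} {u₁ : b₀ ⟶ c₀} {v₁ : b₁ ⟶ c₁} {r : c₀ ⟶ c₁} :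
      R.Entails t u₀ v₀ s → R.Entails s u₁ v₁ r → R.Entails t (u₀ ≫ u₁) (v₀ ≫ v₁) r
  | parallelComp {a₀ a₁ a₂ a₃ b₀ b₁ b₂ b₃ : C} {t₀ : a₀ ⟶ a₁} {u₀ : a₀ ⟶ a₂} {v₀ : a₁ ⟶ a₃}
      {s₀ : a₂ ⟶ a₃} {t₁ : b₀ ⟶ b₁} {u₁ : b₀ ⟶ b₂} {v₁ : b₁ ⟶ b₃} {s₁ : b₂ ⟶ b₃} :
      R.Entails t₀ u₀ v₀ s₀ → R.Entails t₁ u₁ v₁ s₁ →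
        R.Entails (t₀ ⊗ₘ t₁) (u₀ ⊗ₘ u₁) (v₀ ⊗ₘ v₁) (s₀ ⊗ₘ s₁)

/-! ### The double category of pullbacks -/

/-- A flat double category with horizontal and vertical 1-category `C`: the cells are squares of
arrows of `C` and are completely identified by their borders, so that the associativity, unit and
exchange laws for cells hold automatically. -/
structure FlatDoubleCategory (C : Type u) [Category.{v} C] where
  /-- The square with top `t`, left side `u`, right side `v` and bottom `s` is a cell. -/
  IsCell : ∀ {o₀ o₁ o₂ o₃ : C}, (o₀ ⟶ o₁) → (o₀ ⟶ o₂) → (o₁ ⟶ o₃) → (o₂ ⟶ o₃) → Prop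
  horizontalId : ∀ {o₀ o₁ : C} (t : o₀ ⟶ o₁), IsCell t (𝟙 o₀) (𝟙 o₁) t
  verticalId : ∀ {o₀ o₁ : C} (u : o₀ ⟶ o₁), IsCell (𝟙 o₀) u u (𝟙 o₁)
  horizontalComp : ∀ {a₀ a₁ a₂ b₀ b₁ b₂ : C} {t₀ : a₀ ⟶ a₁} {t₁ : a₁ ⟶ a₂} {u : a₀ ⟶ b₀}
    {v : a₁ ⟶ b₁} {w : a₂ ⟶ b₂} {s₀ : b₀ ⟶ b₁} {s₁ : b₁ ⟶ b₂},
    IsCell t₀ u v s₀ → IsCell t₁ v w s₁ → IsCell (t₀ ≫ t₁) u w (s₀ ≫ s₁)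
  verticalComp : ∀ {a₀ a₁ b₀ b₁ c₀ c₁ : C} {t : a₀ ⟶ a₁} {u₀ : a₀ ⟶ b₀} {v₀ : a₁ ⟶ b₁}
    {s : b₀ ⟶ b₁} {u₁ : b₀ ⟶ c₀} {v₁ : b₁ ⟶ c₁} {r : c₀ ⟶ c₁},
    IsCell t u₀ v₀ s → IsCell s u₁ v₁ r → IsCell t (u₀ ≫ u₁) (v₀ ≫ v₁) r

/-- The double category of pullbacks of `C`: the cells are the pullback squares. -/
def pullbackDoubleCategory (C : Type u) [Category.{v} C] : FlatDoubleCategory C where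
  IsCell p₀ p₁ h g := IsPullback p₀ p₁ h g
  horizontalId t := IsPullback.of_vert_isIso ⟨by simp⟩
  verticalId u := IsPullback.of_horiz_isIso ⟨by simp⟩
  horizontalComp h₁ h₂ := h₁.paste_horiz h₂
  verticalComp h₁ h₂ := h₁.paste_vert h₂

/-! ### The pullback basis -/

namespace Th

open FirstOrder Language

variable (L : FirstOrder.Language.{u, v})

/-- The object with one canonical variable. -/
abbrev one : Th L := ⟨1⟩

variable {L}

/-- The basic substitution `f(x₁, …, xₙ)` given by an operator `f` of arity `n`. -/
def oper {n : ℕ} (f : L.Functions n) : (⟨n⟩ : Th L) ⟶ one L :=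
  fun _ => Term.func f Term.var

/-- The duplicator `⟨x₁, …, xₙ, x₁, …, xₙ⟩`. -/
def dup (n : Th L) : n ⟶ n ⊗ n :=
  Fin.append (fun i : Fin n.card => Term.var i) (fun i : Fin n.card => Term.var i)

/-- The symmetry `⟨xₙ₊₁, …, xₙ₊ₘ, x₁, …, xₙ⟩`. -/
def symm (n m : Th L) : n ⊗ m ⟶ m ⊗ n :=
  Fin.append (fun j : Fin m.card => Term.var (Fin.natAdd n.card j))
    (fun i : Fin n.card => Term.var (Fin.castAdd m.card i))

variable (L)

/-- The names of the basic cells: `R_f`, `D_f`, `D̂_f` for every operator `f`, and `R_∇`, `R_γ`,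
`D_∇`. -/
inductive BasisName : Type u
  | opR {n : ℕ} (f : L.Functions n)
  | opD {n : ℕ} (f : L.Functions n)
  | opDHat {n : ℕ} (f : L.Functions n)
  | dupR
  | symmR
  | dupD

/-- The pullback basis `B(L)`, as squares of `Th[L]` whose top and left sides are the projections
`t : P ⟶ X`, `u : P ⟶ Y` and whose right and bottom sides are the arrows `v : X ⟶ Z`,
`s : Y ⟶ Z`. -/
def basisCell : BasisName L → Cell (Th L)
  | .opR f =>
      { t := 𝟙 _, u := 𝟙 _, v := oper f, s := oper f }
  | .opD f =>
      { t := oper f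
        u := dup _ ≫ (𝟙 _ ⊗ₘ oper f)
        v := dup (one L)
        s := oper f ⊗ₘ 𝟙 (one L) }
  | .opDHat f =>
      { t := dup _ ≫ (𝟙 _ ⊗ₘ oper f)
        u := oper f
        v := oper f ⊗ₘ 𝟙 (one L)
        s := dup (one L) }
  | .dupR =>
      { t := 𝟙 _, u := 𝟙 _, v := dup (one L), s := dup (one L) }
  | .symmR =>
      { t := 𝟙 _, u := 𝟙 _, v := symm (one L) (one L), s := symm (one L) (one L) }
  | .dupD =>
      { t := dup (one L)
        u := dup (one L)
        v := (𝟙 (one L) ⊗ₘ dup (one L)) ≫ (α_ (one L) (one L) (one L)).inv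
        s := dup (one L) ⊗ₘ 𝟙 (one L) }

/-- A square of `Th[L]` is generated by the pullback basis if it is a horizontal, vertical and
parallel composite of basic squares and identity squares. -/
def Generated {P X Y Z : Th L} (t : P ⟶ X) (u : P ⟶ Y) (v : X ⟶ Z) (s : Y ⟶ Z) : Prop :=
  (TileSystem.mk (BasisName L) (basisCell L)).Entails t u v s

/-- The tile system for pullbacks. Its horizontal and vertical categories are `Th[L]ᵒᵖ`: the top
`t` and the left side `u` of a tile are the two substitutions to be unified, and the right side `v`
and the bottom `s` are the unifying substitutions. -/
def pullbackTiles : TileSystem (Th L)ᵒᵖ where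
  Name := BasisName L
  rule
    | .opR f =>
        { t := (oper f).op, u := (oper f).op, v := 𝟙 _, s := 𝟙 _ }
    | .opD f =>
        { t := (oper f).op ⊗ₘ 𝟙 (op (one L))
          u := (dup (one L)).op
          v := (dup _ ≫ (𝟙 _ ⊗ₘ oper f)).op
          s := (oper f).op }
    | .opDHat f =>
        { t := (dup (one L)).op
          u := (oper f).op ⊗ₘ 𝟙 (op (one L))
          v := (oper f).op
          s := (dup _ ≫ (𝟙 _ ⊗ₘ oper f)).op }
    | .dupR =>
        { t := (dup (one L)).op, u := (dup (one L)).op, v := 𝟙 _, s := 𝟙 _ }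
    | .symmR =>
        { t := (symm (one L) (one L)).op, u := (symm (one L) (one L)).op, v := 𝟙 _, s := 𝟙 _ }
    | .dupD =>
        { t := (dup (one L) ⊗ₘ 𝟙 (one L)).op
          u := ((𝟙 (one L) ⊗ₘ dup (one L)) ≫ (α_ (one L) (one L) (one L)).inv).op
          v := (dup (one L)).op
          s := (dup (one L)).op }

end Th

/-! Soundness: in `Th L` the tensor is the cartesian product, so pullback squares are closed under
`⊗` as well as under pasting (`isPullback_tensor`), and each basic square is a pullback by
inspection (`isPullback_basis`).

Completeness rests on unification. A most general unifier of `t` and `s` is an equalizer, and the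
equalizer of `t` and `s` is the pullback of the graphs `⟨id, t⟩` and `⟨id, s⟩`. The key generated
squares are those of `gen_graph`: the pullback of `⟨id, t⟩` along `a ⊗ id` is `⟨id, a ; t⟩`, for
every `a` and `t`. They come from the duplicator square of `a`, which is built by induction on terms
from `D_f`, `D_∇` and identity squares (`dupSquare`). Every step of the unification algorithm is
then a pasting: solving equations one after the other is `Gen.pair`, stripping a common operator is
`Gen.graph_func`, and eliminating a variable is an instance of `gen_graph`. The recursion on the
number of variables is `hasMgu`.

A cospan `h`, `g` that some pair of arrows completes to a commuting square is handled by unifying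
`h` and `g` on disjoint variables (`exists_gen`). This produces one generated square over the
cospan, which is a pullback by soundness. Any other pullback differs from it by an isomorphism of
the apex. The isomorphisms of `Th L` are permutations of variables (`exists_eq_permIso`), and these
can be absorbed because `R_γ` generates their mono squares (`monoTile_permIso`). -/

namespace TileSystem

/-! ### Mono squares and transport along isomorphisms -/

variable {C : Type u} [Category.{v} C] [MonoidalCategory C] {R : TileSystem.{u, v, w} C}

/-- The square expressing that `m` is a monomorphism is entailed. -/
def MonoTile (R : TileSystem.{u, v, w} C) {X Z : C} (m : X ⟶ Z) : Prop :=
  R.Entails (𝟙 X) (𝟙 X) m m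

theorem MonoTile.id (X : C) : R.MonoTile (𝟙 X) := Entails.horizontalId _

theorem Entails.comp_monoTile {P X Y Z Z' : C} {t : P ⟶ X} {u : P ⟶ Y} {v : X ⟶ Z} {s : Y ⟶ Z}
    {m : Z ⟶ Z'} (h : R.Entails t u v s) (hm : R.MonoTile m) :
    R.Entails t u (v ≫ m) (s ≫ m) := by
  have h₁ := (Entails.verticalId v).verticalComp hm
  rw [Category.comp_id] at h₁
  simpa using h.horizontalComp h₁

theorem MonoTile.comp {X Y Z : C} {m : X ⟶ Y} {n : Y ⟶ Z} (hm : R.MonoTile m)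
    (hn : R.MonoTile n) : R.MonoTile (m ≫ n) :=
  Entails.comp_monoTile hm hn

theorem MonoTile.tensor {X Y X' Y' : C} {m : X ⟶ Y} {n : X' ⟶ Y'} (hm : R.MonoTile m)
    (hn : R.MonoTile n) : R.MonoTile (m ⊗ₘ n) := by
  simpa [MonoTile] using Entails.parallelComp hm hn

/-- Entailed squares may be transported along isomorphisms of their four corners whose mono
squares are entailed. -/
theorem Entails.conj {P X Y Z P' X' Y' Z' : C} {t : P ⟶ X} {u : P ⟶ Y} {v : X ⟶ Z}
    {s : Y ⟶ Z} (h : R.Entails t u v s) (φ : P' ≅ P) (ψ : X ≅ X') (χ : Y ≅ Y') (ω : Z ≅ Z')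
    (hφ : R.MonoTile φ.inv) (hψ : R.MonoTile ψ.inv) (hχ : R.MonoTile χ.inv)
    (hω : R.MonoTile ω.hom) :
    R.Entails (φ.hom ≫ t ≫ ψ.hom) (φ.hom ≫ u ≫ χ.hom) (ψ.inv ≫ v ≫ ω.hom)
      (χ.inv ≫ s ≫ ω.hom) := by
  -- Pasting the mono square of an inverse with identity squares cancels the isomorphism on one
  -- side. This gives the squares `h₁`, `h₂`, `h₃` that insert an isomorphism at the apex and at the
  -- two intermediate corners.
  have h₁ : R.Entails φ.hom φ.hom (𝟙 P) (𝟙 P) := by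
    have := (Entails.verticalId φ.hom).verticalComp hφ
    rw [Iso.hom_inv_id, Category.comp_id] at this
    simpa using this.horizontalComp (Entails.horizontalId φ.hom)
  have h₂ : R.Entails ψ.hom v (ψ.inv ≫ v) (𝟙 Z) := by
    have := (Entails.horizontalId ψ.hom).horizontalComp hψ
    rw [Iso.hom_inv_id, Category.comp_id] at this
    simpa using this.verticalComp (Entails.verticalId v)
  have h₃ : R.Entails s χ.hom (𝟙 Z) (χ.inv ≫ s) := by
    have := (Entails.verticalId χ.hom).verticalComp hχ
    rw [Iso.hom_inv_id, Category.comp_id] at this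
    simpa using this.horizontalComp (Entails.horizontalId s)
  have h₄ : R.Entails (φ.hom ≫ t) (φ.hom ≫ u) v s := by
    have := h₁.horizontalComp (Entails.horizontalId t)
    rw [Category.id_comp] at this
    simpa using this.verticalComp h
  have h₅ := h₄.horizontalComp h₂
  rw [Category.comp_id] at h₅
  have h₆ := h₅.verticalComp h₃
  rw [Category.comp_id] at h₆
  simpa using h₆.comp_monoTile hω

end TileSystem

/-! ### Permutations of variables -/

namespace Th

open FirstOrder Language

variable {L : FirstOrder.Language.{u, v}}

/-- The isomorphism of `Th[L]` which renames variables along a bijection. -/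
def permIso {m n : ℕ} (e : Fin m ≃ Fin n) : (⟨n⟩ : Th L) ≅ ⟨m⟩ where
  hom := fun i => Term.var (e i)
  inv := fun i => Term.var (e.symm i)
  hom_inv_id := hom_ext fun i => by simp [comp_apply, id_apply]
  inv_hom_id := hom_ext fun i => by simp [comp_apply, id_apply]

variable (L) in
/-- The tile system whose entailed tiles are the squares generated by the pullback basis. -/
abbrev basisTiles : TileSystem.{0, u, u} (Th L) :=
  ⟨BasisName L, basisCell L⟩

/-- An adjacent transposition is `id ⊗ γ ⊗ id`, so its mono square is `R_γ` tensored with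
identities. -/
theorem monoTile_swap (i k : ℕ) : (basisTiles L).MonoTile
    (permIso (Equiv.swap (⟨i, by omega⟩ : Fin (i + (1 + 1) + k)) ⟨i + 1, by omega⟩)).hom := by
  have h := (TileSystem.MonoTile.tensor (TileSystem.MonoTile.tensor
    (TileSystem.MonoTile.id (R := basisTiles L) (⟨i⟩ : Th L))
    (show (basisTiles L).MonoTile (symm (one L) (one L)) from
      TileSystem.Entails.basic (R := basisTiles L) BasisName.symmR)) (TileSystem.MonoTile.id ⟨k⟩))
  have e : (permIso (Equiv.swap (⟨i, by omega⟩ : Fin (i + (1 + 1) + k)) ⟨i + 1, by omega⟩)).hom =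
      (𝟙 (⟨i⟩ : Th L) ⊗ₘ symm (one L) (one L)) ⊗ₘ 𝟙 (⟨k⟩ : Th L) := by
    refine hom_ext_tensor (fun j => ?_) (fun j => ?_)
    · rw [tensor_left]
      revert j
      refine Fin.addCases (fun j => ?_) (fun j => ?_)
      · refine Eq.trans ?_ (congrArg _ (tensor_left (𝟙 (⟨i⟩ : Th L)) _ j).symm)
        refine congrArg Term.var (Equiv.swap_apply_of_ne_of_ne ?_ ?_) <;>
        · refine Fin.ne_of_val_ne ?_
          have : j.1 < i := j.2
          simp
          omega
      · refine Eq.trans ?_ (congrArg _ (tensor_right (𝟙 (⟨i⟩ : Th L)) _ j).symm)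
        change Fin 2 at j
        fin_cases j
        · exact congrArg Term.var (Equiv.swap_apply_left _ _)
        · exact congrArg Term.var (Equiv.swap_apply_right _ _)
    · refine Eq.trans ?_ (tensor_right (𝟙 (⟨i⟩ : Th L) ⊗ₘ symm (one L) (one L)) _ j).symm
      refine congrArg Term.var (Equiv.swap_apply_of_ne_of_ne ?_ ?_) <;>
      · refine Fin.ne_of_val_ne ?_
        change i + (1 + 1) + j.1 ≠ _
        simp
        try omega
  rw [e]
  exact h

/-- Adjacent transpositions generate the symmetric group as a monoid, and mono squares compose. -/
theorem monoTile_permIso {m n : ℕ} (e : Fin m ≃ Fin n) :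
    (basisTiles L).MonoTile (permIso e).hom := by
  obtain rfl : m = n := by simpa using Fintype.card_congr e
  cases m with
  | zero =>
    rw [show (permIso e).hom = 𝟙 (⟨0⟩ : Th L) from hom_ext fun i => i.elim0]
    exact TileSystem.MonoTile.id _
  | succ m =>
    have he : e ∈ Submonoid.closure (Set.range fun i : Fin m ↦ Equiv.swap i.castSucc i.succ) := by
      rw [Equiv.Perm.mclosure_swap_castSucc_succ]; trivial
    induction he using Submonoid.closure_induction with
    | mem x hx =>
      obtain ⟨⟨i, hi⟩, rfl⟩ := hx
      obtain ⟨k, rfl⟩ := Nat.exists_eq_add_of_lt hi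
      have h := monoTile_swap (L := L) i k
      have e : i + (1 + 1) + k = i + k + 1 + 1 := by omega
      revert h
      generalize_proofs p q
      revert p q
      rw [e]
      exact fun _ _ h => h
    | one => exact TileSystem.MonoTile.id _
    | mul x y _ _ hx hy => exact hx.comp hy

/-! ### Squares whose corners are finite sets of variables -/

section

variable {α α' β β' γ γ' δ : Type}

/-- The composite of two families of terms, in diagrammatic order. -/
def sub (a : β → L.Term α) (b : γ → L.Term β) : γ → L.Term α := fun i => (b i).subst a

/-- The juxtaposition of two families of terms on disjoint variables. -/
def par (a : β → L.Term α) (b : β' → L.Term α') : β ⊕ β' → L.Term (α ⊕ α') :=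
  Sum.elim (fun i => (a i).relabel Sum.inl) (fun i => (b i).relabel Sum.inr)

/-- The family `⟨id, t⟩`. -/
def graph (t : γ → L.Term α) : α ⊕ γ → L.Term α := Sum.elim Term.var t

/-- The arrow of `Th[L]` given by a family of terms and numberings of the variables and of the
entries. -/
def toHom {n m : ℕ} (eα : Fin n ≃ α) (eβ : Fin m ≃ β) (a : β → L.Term α) :
    (⟨n⟩ : Th L) ⟶ ⟨m⟩ :=
  fun i => (a (eβ i)).relabel eα.symm

theorem toHom_var {n : ℕ} (e : Fin n ≃ α) : toHom e e (Term.var : α → L.Term α) = 𝟙 _ :=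
  hom_ext fun i => by simp [toHom, id_apply]

theorem toHom_sub {n m k : ℕ} (eα : Fin n ≃ α) (eβ : Fin m ≃ β) (eγ : Fin k ≃ γ)
    (a : β → L.Term α) (b : γ → L.Term β) :
    toHom eα eγ (sub a b) = toHom eα eβ a ≫ toHom eβ eγ b :=
  hom_ext fun i => by simp [toHom, comp_apply, sub, relabel_eq_subst, subst_subst]

/-- The numbering of a disjoint union which starts with the first summand. -/
def sumNumbering {n m : ℕ} (e : Fin n ≃ α) (f : Fin m ≃ β) : Fin (n + m) ≃ α ⊕ β :=
  finSumFinEquiv.symm.trans (Equiv.sumCongr e f)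

theorem toHom_par {n m n' m' : ℕ} (eα : Fin n ≃ α) (eβ : Fin m ≃ β) (eα' : Fin n' ≃ α')
    (eβ' : Fin m' ≃ β') (a : β → L.Term α) (b : β' → L.Term α') :
    toHom (sumNumbering eα eα') (sumNumbering eβ eβ') (par a b) =
      toHom eα eβ a ⊗ₘ toHom eα' eβ' b := by
  refine hom_ext_tensor (fun i => ?_) (fun i => ?_)
  · rw [tensor_left]
    simp [toHom, sumNumbering, par, Function.comp_def]
  · rw [tensor_right]
    simp [toHom, sumNumbering, par, Function.comp_def]

theorem permIso_conj_toHom {n m n' m' : ℕ} (eα : Fin n ≃ α) (eβ : Fin m ≃ β) (eα' : Fin n' ≃ α)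
    (eβ' : Fin m' ≃ β) (a : β → L.Term α) :
    (permIso (eα.trans eα'.symm)).hom ≫ toHom eα eβ a ≫ (permIso (eβ'.trans eβ.symm)).hom =
      toHom eα' eβ' a :=
  hom_ext fun i => by
    simp [toHom, comp_apply, relabel_eq_subst, subst_subst, permIso]

end

/-- The square with the given sides, whose corners are finite sets of variables, is generated by
the pullback basis after numbering the corners. -/
def Gen {P X Y Z : Type} (t : X → L.Term P) (u : Y → L.Term P) (v : Z → L.Term X)
    (s : Z → L.Term Y) : Prop :=
  ∃ (nP nX nY nZ : ℕ) (eP : Fin nP ≃ P) (eX : Fin nX ≃ X) (eY : Fin nY ≃ Y) (eZ : Fin nZ ≃ Z),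
    Generated L (toHom eP eX t) (toHom eP eY u) (toHom eX eZ v) (toHom eY eZ s)

namespace Gen

variable {P X Y Z P' X' Y' Z' : Type}

/-- Two numberings of a corner differ by a permutation, which `TileSystem.Entails.conj` absorbs.
Hence the choice of numberings in `Gen` is immaterial, and squares can be pasted along edges that
were numbered differently. -/
theorem generated {t : X → L.Term P} {u : Y → L.Term P} {v : Z → L.Term X} {s : Z → L.Term Y}
    (h : Gen t u v s) {nP nX nY nZ : ℕ} (eP : Fin nP ≃ P) (eX : Fin nX ≃ X) (eY : Fin nY ≃ Y)
    (eZ : Fin nZ ≃ Z) :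
    Generated L (toHom eP eX t) (toHom eP eY u) (toHom eX eZ v) (toHom eY eZ s) := by
  obtain ⟨mP, mX, mY, mZ, fP, fX, fY, fZ, h⟩ := h
  have := TileSystem.Entails.conj h (permIso (fP.trans eP.symm)) (permIso (eX.trans fX.symm))
    (permIso (eY.trans fY.symm)) (permIso (eZ.trans fZ.symm))
    (monoTile_permIso (eP.trans fP.symm)) (monoTile_permIso (fX.trans eX.symm))
    (monoTile_permIso (fY.trans eY.symm)) (monoTile_permIso (eZ.trans fZ.symm))
  rw [permIso_conj_toHom, permIso_conj_toHom] at this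
  have e₁ := permIso_conj_toHom fX fZ eX eZ v
  have e₂ := permIso_conj_toHom fY fZ eY eZ s
  rw [← e₁, ← e₂]
  exact this

theorem congr {t : X → L.Term P} {u : Y → L.Term P} {v : Z → L.Term X} {s : Z → L.Term Y}
    (h : Gen t u v s) (eP : P ≃ P') (eX : X ≃ X') (eY : Y ≃ Y') (eZ : Z ≃ Z')
    {t' : X' → L.Term P'} {u' : Y' → L.Term P'} {v' : Z' → L.Term X'} {s' : Z' → L.Term Y'}
    (ht : ∀ i, t' (eX i) = (t i).relabel eP) (hu : ∀ i, u' (eY i) = (u i).relabel eP)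
    (hv : ∀ i, v' (eZ i) = (v i).relabel eX) (hs : ∀ i, s' (eZ i) = (s i).relabel eY) :
    Gen t' u' v' s' := by
  obtain ⟨mP, mX, mY, mZ, fP, fX, fY, fZ, h⟩ := h
  refine ⟨mP, mX, mY, mZ, fP.trans eP, fX.trans eX, fY.trans eY, fZ.trans eZ, ?_⟩
  convert h using 1 <;> refine hom_ext fun i => ?_ <;>
    simp [toHom, ht, hu, hv, hs, Function.comp_def]

theorem hcomp {A₀ A₁ A₂ B₀ B₁ B₂ : Type} {t₀ : A₁ → L.Term A₀} {t₁ : A₂ → L.Term A₁}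
    {u : B₀ → L.Term A₀} {v : B₁ → L.Term A₁} {w : B₂ → L.Term A₂} {s₀ : B₁ → L.Term B₀}
    {s₁ : B₂ → L.Term B₁} (h₀ : Gen t₀ u v s₀) (h₁ : Gen t₁ v w s₁) :
    Gen (sub t₀ t₁) u w (sub s₀ s₁) := by
  obtain ⟨_, _, _, _, e₀, e₁, e₂, e₃, h₀⟩ := h₀
  obtain ⟨_, _, _, _, _, f₁, _, f₃, -⟩ := id h₁
  refine ⟨_, _, _, _, e₀, f₁, e₂, f₃, ?_⟩
  rw [toHom_sub e₀ e₁, toHom_sub e₂ e₃]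
  exact TileSystem.Entails.horizontalComp h₀ (h₁.generated e₁ f₁ e₃ f₃)

theorem vcomp {A₀ A₁ B₀ B₁ C₀ C₁ : Type} {t : A₁ → L.Term A₀} {u₀ : B₀ → L.Term A₀}
    {v₀ : B₁ → L.Term A₁} {s : B₁ → L.Term B₀} {u₁ : C₀ → L.Term B₀} {v₁ : C₁ → L.Term B₁}
    {r : C₁ → L.Term C₀} (h₀ : Gen t u₀ v₀ s) (h₁ : Gen s u₁ v₁ r) :
    Gen t (sub u₀ u₁) (sub v₀ v₁) r := by
  obtain ⟨_, _, _, _, e₀, e₁, e₂, e₃, h₀⟩ := h₀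
  obtain ⟨_, _, _, _, _, _, f₂, f₃, -⟩ := id h₁
  refine ⟨_, _, _, _, e₀, e₁, f₂, f₃, ?_⟩
  rw [toHom_sub e₀ e₂, toHom_sub e₁ e₃]
  exact TileSystem.Entails.verticalComp h₀ (h₁.generated e₂ e₃ f₂ f₃)

theorem par {t : X → L.Term P} {u : Y → L.Term P} {v : Z → L.Term X} {s : Z → L.Term Y}
    {t' : X' → L.Term P'} {u' : Y' → L.Term P'} {v' : Z' → L.Term X'} {s' : Z' → L.Term Y'}
    (h : Gen t u v s) (h' : Gen t' u' v' s') :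
    Gen (par t t') (par u u') (par v v') (par s s') := by
  obtain ⟨_, _, _, _, e₀, e₁, e₂, e₃, h⟩ := h
  obtain ⟨_, _, _, _, f₀, f₁, f₂, f₃, h'⟩ := h'
  refine ⟨_, _, _, _, sumNumbering e₀ f₀, sumNumbering e₁ f₁, sumNumbering e₂ f₂,
    sumNumbering e₃ f₃, ?_⟩
  rw [toHom_par, toHom_par, toHom_par, toHom_par]
  exact TileSystem.Entails.parallelComp h h'

theorem horizontalId [Finite P] [Finite X] (t : X → L.Term P) :
    Gen t Term.var Term.var t := by
  obtain ⟨n, ⟨e⟩⟩ := Finite.exists_equiv_fin P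
  obtain ⟨m, ⟨f⟩⟩ := Finite.exists_equiv_fin X
  refine ⟨_, _, _, _, e.symm, f.symm, e.symm, f.symm, ?_⟩
  rw [toHom_var, toHom_var]
  exact TileSystem.Entails.horizontalId _

theorem verticalId [Finite P] [Finite X] (t : X → L.Term P) :
    Gen Term.var t t Term.var := by
  obtain ⟨n, ⟨e⟩⟩ := Finite.exists_equiv_fin P
  obtain ⟨m, ⟨f⟩⟩ := Finite.exists_equiv_fin X
  refine ⟨_, _, _, _, e.symm, e.symm, f.symm, f.symm, ?_⟩
  rw [toHom_var, toHom_var]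
  exact TileSystem.Entails.verticalId _

theorem of_generated {nP nX nY nZ : ℕ} {t : Fin nX → L.Term (Fin nP)}
    {u : Fin nY → L.Term (Fin nP)} {v : Fin nZ → L.Term (Fin nX)} {s : Fin nZ → L.Term (Fin nY)}
    (h : Generated L (P := ⟨nP⟩) (X := ⟨nX⟩) (Y := ⟨nY⟩) (Z := ⟨nZ⟩) t u v s) : Gen t u v s := by
  refine ⟨_, _, _, _, Equiv.refl _, Equiv.refl _, Equiv.refl _, Equiv.refl _, ?_⟩
  convert h using 1 <;> exact hom_ext fun i => Term.relabel_id _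

end Gen

/-! ### Duplicator squares of arbitrary arrows -/

theorem var_sub {α β : Type} (a : β → L.Term α) : sub Term.var a = a :=
  funext fun i => subst_var (a i)

theorem par_var_var {α β : Type} :
    par (Term.var : α → L.Term α) (Term.var : β → L.Term β) = Term.var := by
  funext i
  rcases i with i | i <;> rfl

/-- The pullback square of a duplicator along the arrow `a`. -/
def DupSquare {α β : Type} (a : β → L.Term α) : Prop :=
  Gen a (graph a) (graph (Term.var : β → L.Term β)) (par a Term.var)

theorem dup_comp_tensor_left {k m n : Th L} (σ : k ⟶ m) (τ : k ⟶ n) (i : Fin m.card) :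
    (dup k ≫ (σ ⊗ₘ τ)) (Fin.castAdd n.card i) = σ i := by
  rw [comp_apply, tensor_left, subst_relabel]
  simp only [dup, Fin.append_left, subst_var]

theorem dup_comp_tensor_right {k m n : Th L} (σ : k ⟶ m) (τ : k ⟶ n) (i : Fin n.card) :
    (dup k ≫ (σ ⊗ₘ τ)) (Fin.natAdd m.card i) = τ i := by
  rw [comp_apply, tensor_right, subst_relabel]
  simp only [dup, Fin.append_right, subst_var]

theorem generated_basis (b : BasisName L) : Generated L (basisCell L b).t (basisCell L b).u
    (basisCell L b).v (basisCell L b).s :=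
  TileSystem.Entails.basic (R := basisTiles L) b

theorem gen_oper_mono {n : ℕ} (f : L.Functions n) :
    Gen Term.var Term.var (oper f : Fin 1 → L.Term (Fin n)) (oper f) :=
  Gen.of_generated (generated_basis (.opR f))

theorem gen_dup_mono : Gen Term.var Term.var (graph (Term.var : Fin 1 → L.Term (Fin 1)))
    (graph Term.var) := by
  refine (Gen.of_generated (generated_basis (L := L) .dupR)).congr (Equiv.refl _) (Equiv.refl _)
    (Equiv.refl _) (finSumFinEquiv (m := 1) (n := 1)).symm ?_ ?_ ?_ ?_ <;>
  · intro i
    fin_cases i <;> rfl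

theorem dupSquare_oper {n : ℕ} (f : L.Functions n) :
    DupSquare (oper f : Fin 1 → L.Term (Fin n)) := by
  refine (Gen.of_generated (generated_basis (.opD f))).congr (Equiv.refl _) (Equiv.refl _)
    (finSumFinEquiv (m := n) (n := 1)).symm (finSumFinEquiv (m := 1) (n := 1)).symm ?_ ?_ ?_ ?_
  · intro i
    exact (Term.relabel_id _).symm
  · refine Fin.addCases (fun i => ?_) (fun i => ?_)
    · refine Eq.trans ?_ (congrArg _ (dup_comp_tensor_left (𝟙 (⟨n⟩ : Th L)) (oper f) i).symm)
      exact congrArg (graph (oper f)) (finSumFinEquiv_symm_apply_castAdd i)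
    · refine Eq.trans ?_ (congrArg _ (dup_comp_tensor_right (𝟙 (⟨n⟩ : Th L)) (oper f) i).symm)
      exact (congrArg (graph (oper f)) (finSumFinEquiv_symm_apply_natAdd i)).trans
        (Term.relabel_id _).symm
  · intro i
    fin_cases i <;> rfl
  · refine Fin.addCases (fun i => ?_) (fun i => ?_)
    · refine Eq.trans ?_ (congrArg _ (tensor_left (oper f) (𝟙 (one L)) i).symm)
      refine (congrArg (par (oper f) Term.var) (finSumFinEquiv_symm_apply_castAdd i)).trans ?_
      refine Eq.trans ?_ (Term.relabel_relabel _ _ _).symm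
      refine congrArg (fun g => Term.relabel g (oper f i)) ?_
      funext j
      exact (finSumFinEquiv_symm_apply_castAdd j).symm
    · refine Eq.trans ?_ (congrArg _ (tensor_right (oper f) (𝟙 (one L)) i).symm)
      refine (congrArg (par (oper f) Term.var) (finSumFinEquiv_symm_apply_natAdd i)).trans ?_
      exact congrArg Term.var (finSumFinEquiv_symm_apply_natAdd i).symm

/-- The square `D_∇` in terms of numbered variables. -/
theorem gen_dupD : Gen (P := Fin 1) (X := Fin 2) (Y := Fin 2) (Z := Fin 3)
    (fun _ => (Term.var 0 : L.Term _)) (fun _ => Term.var 0) (fun i => Term.var (![0, 1, 1] i))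
    (fun i => Term.var (![0, 0, 1] i)) := by
  refine (Gen.of_generated (generated_basis (L := L) .dupD)).congr (Equiv.refl _) (Equiv.refl _)
    (Equiv.refl _) (Equiv.refl _) ?_ ?_ ?_ ?_ <;>
  · intro i
    fin_cases i <;> rfl

theorem Generated.of_eq {P X Y Z : Th L} {t t' : P ⟶ X} {u u' : P ⟶ Y} {v v' : X ⟶ Z}
    {s s' : Y ⟶ Z} (h : Generated L t u v s) (ht : t = t') (hu : u = u') (hv : v = v')
    (hs : s = s') : Generated L t' u' v' s' := by
  subst ht hu hv hs
  exact h

/-- The basis is closed under transposition: `D_f` and `D̂_f` are exchanged, and the other squares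
are symmetric, `D_∇` only up to renumbering. This is the only use of `D̂_f` in completeness. -/
theorem entails_transpose {P X Y Z : Th L} {t : P ⟶ X} {u : P ⟶ Y} {v : X ⟶ Z} {s : Y ⟶ Z}
    (h : (basisTiles L).Entails t u v s) : (basisTiles L).Entails u t s v := by
  induction h with
  | basic b =>
    cases b with
    | opR f => exact generated_basis (.opR f)
    | opD f => exact generated_basis (.opDHat f)
    | opDHat f => exact generated_basis (.opD f)
    | dupR => exact generated_basis .dupR
    | symmR => exact generated_basis .symmR
    | dupD =>
      have h : Gen (P := Fin 1) (X := Fin 2) (Y := Fin 2) (Z := Fin 3)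
          (fun _ => (Term.var 0 : L.Term _)) (fun _ => Term.var 0)
          (fun i => Term.var (![0, 0, 1] i)) (fun i => Term.var (![0, 1, 1] i)) := by
        -- Reversing the order of the variables at every corner exchanges `id ⊗ ∇` and `∇ ⊗ id`.
        refine gen_dupD.congr (Equiv.refl _) (Equiv.swap 0 1) (Equiv.swap 0 1) (Equiv.swap 0 2)
          ?_ ?_ ?_ ?_ <;> intro i <;> fin_cases i <;> rfl
      refine (h.generated (Equiv.refl _) (Equiv.refl _) (Equiv.refl _) (Equiv.refl _)).of_eq
        ?_ ?_ ?_ ?_ <;> refine hom_ext fun i => ?_ <;> fin_cases i <;> rfl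
  | horizontalId t => exact .verticalId t
  | verticalId t => exact .horizontalId t
  | horizontalComp _ _ h h' => exact h.verticalComp h'
  | verticalComp _ _ h h' => exact h.horizontalComp h'
  | parallelComp _ _ h h' => exact h.parallelComp h'

theorem Gen.transpose {P X Y Z : Type} {t : X → L.Term P} {u : Y → L.Term P} {v : Z → L.Term X}
    {s : Z → L.Term Y} (h : Gen t u v s) : Gen u t s v := by
  obtain ⟨_, _, _, _, e₀, e₁, e₂, e₃, h⟩ := h
  exact ⟨_, _, _, _, e₀, e₂, e₁, e₃, entails_transpose h⟩

section

variable {α α' β β' γ γ' δ : Type}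

/-- Paste below the duplicator square the interchange square of `a ⊗ id` and `id ⊗ t`, a tensor of
two identity squares. -/
theorem DupSquare.graph_square {a : β → L.Term α} (h : DupSquare a) [Finite α] [Finite β]
    [Finite γ] (t : γ → L.Term β) :
    Gen a (graph (sub a t)) (graph t) (par a (Term.var : γ → L.Term γ)) := by
  have := Gen.vcomp h ((Gen.horizontalId a).par (Gen.verticalId t))
  convert this using 1 <;> funext i <;> rcases i with i | i <;>
    simp [graph, sub, par, relabel_eq_subst, subst_subst, subst_var]

theorem DupSquare.comp {a : β → L.Term α} {b : γ → L.Term β} [Finite α] [Finite β]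
    [Finite γ] (ha : DupSquare a) (hb : DupSquare b) : DupSquare (sub a b) := by
  have := Gen.hcomp (ha.graph_square b) hb
  unfold DupSquare
  convert this using 1
  funext i
  rcases i with i | i <;> simp [sub, par, relabel_eq_subst, subst_subst]

theorem DupSquare.congr {a : β → L.Term α} (h : DupSquare a) (e : α ≃ α') (f : β ≃ β')
    {a' : β' → L.Term α'} (ha : ∀ i, a' (f i) = (a i).relabel e) : DupSquare a' := by
  refine Gen.congr h e f (Equiv.sumCongr e f) (Equiv.sumCongr f f) ha ?_ ?_ ?_ <;> intro i <;>
    rcases i with i | i <;> simp [graph, par, ha, Function.comp_def]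

theorem DupSquare.par {a : β → L.Term α} {b : β' → L.Term α'} (ha : DupSquare a)
    (hb : DupSquare b) : DupSquare (par a b) := by
  refine (Gen.par ha hb).congr (Equiv.refl _) (Equiv.refl _) (Equiv.sumSumSumComm _ _ _ _)
    (Equiv.sumSumSumComm _ _ _ _) ?_ ?_ ?_ ?_ <;> intro i <;> rcases i with i | i <;>
    try rcases i with i | i
  all_goals simp [graph, Th.par, Function.comp_def, relabel_eq_subst, subst_subst, subst_var]

theorem dupSquare_var [Finite α] : DupSquare (Term.var : α → L.Term α) := by
  rw [DupSquare, par_var_var]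
  exact Gen.verticalId _

/-- With no entries, both vertical sides are identities up to renumbering. So discarding variables
needs no basic square. -/
theorem dupSquare_of_isEmpty [Finite α] [IsEmpty β] (a : β → L.Term α) : DupSquare a := by
  refine (Gen.horizontalId a).congr (Equiv.refl _) (Equiv.refl _) (Equiv.sumEmpty _ _).symm
    (Equiv.sumEmpty _ _).symm ?_ ?_ ?_ ?_ <;> intro i <;> try exact isEmptyElim i
  · simp [graph]

/-- The square is `D_∇` pasted on top of `D_∇ ⊗ id`. The bijections `X`, `Y`, `Z`, `X'` reorder the
corners so that the common edge matches. -/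
theorem dupSquare_dup_one : DupSquare (graph (Term.var : Fin 1 → L.Term (Fin 1))) := by
  let X : Fin 2 ⊕ Fin 1 ≃ Fin 3 := Equiv.ofBijective
    (Sum.elim ![1, 0] ![2]) (by decide)
  let Y : Fin 2 ⊕ Fin 1 ≃ Fin 1 ⊕ (Fin 1 ⊕ Fin 1) := Equiv.ofBijective
    (Sum.elim ![.inl 0, .inr (.inr 0)] ![.inr (.inl 0)]) (by decide)
  let Z : Fin 3 ⊕ Fin 1 ≃ (Fin 1 ⊕ Fin 1) ⊕ (Fin 1 ⊕ Fin 1) := Equiv.ofBijective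
    (Sum.elim ![.inl (.inl 0), .inl (.inr 0), .inr (.inr 0)] ![.inr (.inl 0)]) (by decide)
  let X' : Fin 2 ≃ Fin 1 ⊕ Fin 1 := Equiv.ofBijective ![.inr 0, .inl 0] (by decide)
  have h₂ : Gen (P := Fin 2) (X := Fin 3) (Y := Fin 1 ⊕ (Fin 1 ⊕ Fin 1))
      (Z := (Fin 1 ⊕ Fin 1) ⊕ (Fin 1 ⊕ Fin 1)) (fun i => (Term.var (![0, 0, 1] i) : L.Term (Fin 2)))
      (Sum.elim (fun _ => Term.var 0) (Sum.elim (fun _ => Term.var 1) (fun _ => Term.var 0)))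
      (Sum.elim (Sum.elim (fun _ => Term.var 1) (fun _ => Term.var 0))
        (Sum.elim (fun _ => Term.var 2) (fun _ => Term.var 0)))
      (par (graph (Term.var : Fin 1 → L.Term (Fin 1))) Term.var) := by
    refine (gen_dupD.par (Gen.horizontalId (Term.var : Fin 1 → L.Term (Fin 1)))).congr
      (finSumFinEquiv (m := 1) (n := 1)) X Y Z ?_ ?_ ?_ ?_ <;> intro i <;>
      rcases i with i | i <;> fin_cases i <;> rfl
  have h₁ : Gen (P := Fin 1) (X := Fin 1 ⊕ Fin 1) (Y := Fin 2) (Z := Fin 3)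
      (fun _ => (Term.var 0 : L.Term _)) (fun _ => Term.var 0)
      (fun i => Term.var (![.inr 0, .inl 0, .inl 0] i)) (fun i => Term.var (![0, 0, 1] i)) := by
    refine gen_dupD.congr (Equiv.refl _) X' (Equiv.refl _) (Equiv.refl _) ?_ ?_ ?_ ?_ <;>
      intro i <;> fin_cases i <;> rfl
  unfold DupSquare
  convert h₁.vcomp h₂ using 1 <;> funext i <;> fin_cases i <;> rfl

theorem dupSquare_dup (α : Type) [Finite α] :
    DupSquare (graph (Term.var : α → L.Term α)) := by
  induction α using Finite.induction_empty_option with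
  | of_equiv e h =>
    refine h.congr e (Equiv.sumCongr e e) fun i => ?_
    rcases i with i | i <;> rfl
  | h_empty => exact dupSquare_of_isEmpty _
  | h_option h =>
    rename_i α _
    let e : Fin 1 ≃ PUnit.{1} := Equiv.ofUnique _ _
    let f := (Equiv.sumCongr (Equiv.refl α) e).trans (Equiv.optionEquivSumPUnit α).symm
    refine (h.par dupSquare_dup_one).congr f
      ((Equiv.sumSumSumComm _ _ _ _).trans (Equiv.sumCongr f f)) fun i => ?_
    rcases i with (i | i) | (i | i) <;> rfl

/-- A pairing factors as `⟨a, b⟩ = ∇ ; (a ⊗ b)`. -/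
theorem DupSquare.pair [Finite α] [Finite β] [Finite γ] {a : β → L.Term α} {b : γ → L.Term α}
    (ha : DupSquare a) (hb : DupSquare b) : DupSquare (Sum.elim a b) := by
  convert (dupSquare_dup α).comp (ha.par hb)
  funext i
  rcases i with i | i <;> simp [sub, graph, Th.par, relabel_eq_subst, subst_subst, subst_var]

theorem dupSquare_tuple [Finite α] {k : ℕ} {a : Fin k → L.Term α}
    (h : ∀ i, DupSquare fun _ : Fin 1 => a i) : DupSquare a := by
  induction k with
  | zero => exact dupSquare_of_isEmpty a
  | succ k ih =>
    refine ((ih (a := fun i => a i.castSucc) fun i => h _).pair (h (Fin.last k))).congr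
      (Equiv.refl _) finSumFinEquiv fun i => ?_
    rcases i with i | i
    · simp [Fin.castSucc]
    · obtain rfl := Subsingleton.elim i 0
      simp [Fin.last, Fin.natAdd]

theorem dupSquare_term [Finite α] (s : L.Term α) : DupSquare fun _ : Fin 1 => s := by
  classical
  induction s with
  | var x =>
    -- A variable is a projection: the identity on `x` tensored with the arrow that discards the
    -- other variables.
    let e : Fin 1 ⊕ {y // ¬ y = x} ≃ α := (Equiv.sumCongr (Equiv.ofUnique (Fin 1) {y // y = x})
      (Equiv.refl _)).trans (Equiv.sumCompl (· = x))
    refine (dupSquare_var.par (dupSquare_of_isEmpty (β := Fin 0) Fin.elim0)).congr e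
      (Equiv.sumEmpty _ _) fun i => ?_
    rcases i with i | i
    · rfl
    · exact i.elim0
  | func f ts ih => exact (dupSquare_tuple ih).comp (dupSquare_oper f)

theorem dupSquare [Finite α] [Finite β] (a : β → L.Term α) : DupSquare a := by
  obtain ⟨k, ⟨e⟩⟩ := Finite.exists_equiv_fin β
  exact (dupSquare_tuple (a := a ∘ e.symm) fun i => dupSquare_term _).congr (Equiv.refl _) e.symm
    fun i => (Term.relabel_id _).symm

/-- The pullback of `⟨id, t⟩` along `a ⊗ id` is `⟨id, a ; t⟩`. -/
theorem gen_graph [Finite α] [Finite β] [Finite γ] (a : β → L.Term α) (t : γ → L.Term β) :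
    Gen a (graph (sub a t)) (graph t) (par a (Term.var : γ → L.Term γ)) :=
  (dupSquare a).graph_square t

end

/-! ### Generated squares between graphs -/

section

variable {P X Y Z Z' W V V₁ V₂ Z₁ Z₂ : Type}

theorem Gen.comp_mono {t : X → L.Term P} {u : Y → L.Term P} {v : Z → L.Term X}
    {s : Z → L.Term Y} {m : Z' → L.Term Z} [Finite X] [Finite Z] (h : Gen t u v s)
    (hm : Gen Term.var Term.var m m) : Gen t u (sub v m) (sub s m) :=
  h.hcomp ((Gen.verticalId v).vcomp hm)

/-- The square obtained by unifying the last entries of two tuples and then the first ones. -/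
theorem Gen.pair [Finite V₁] [Finite V₂] [Finite W] [Finite Z₁] [Finite Z₂]
    {q₂ : W → L.Term V₂} {q₁ : V₂ → L.Term V₁} {t₁ s₁ : Z₁ → L.Term W} {t₂ s₂ : Z₂ → L.Term W}
    (h₂ : Gen q₂ q₂ (graph t₂) (graph s₂))
    (h₁ : Gen q₁ q₁ (graph (sub q₂ t₁)) (graph (sub q₂ s₁))) :
    Gen (sub q₁ q₂) (sub q₁ q₂) (graph (Sum.elim t₁ t₂)) (graph (Sum.elim s₁ s₂)) := by
  -- A two-by-two grid: `h₁` top left and `h₂ ⊗ id` bottom right. The two other squares instantiate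
  -- `t₁` and `s₁` by `q₂`.
  have h := (h₁.hcomp (gen_graph q₂ t₁)).vcomp ((gen_graph q₂ s₁).transpose.hcomp
    (h₂.par (Gen.horizontalId (Term.var : Z₁ → L.Term Z₁))))
  refine h.congr (Equiv.refl _) (Equiv.refl _) (Equiv.refl _)
    ((Equiv.sumAssoc _ _ _).trans (Equiv.sumCongr (Equiv.refl _) (Equiv.sumComm _ _)))
    (fun i => (Term.relabel_id _).symm) (fun i => (Term.relabel_id _).symm) ?_ ?_ <;>
  · rintro ((i | i) | i) <;>
      simp [sub, graph, Th.par, relabel_eq_subst, subst_subst, subst_var]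

/-- Postcomposing both graphs with `id ⊗ f` keeps the projections, since `R_f` makes `id ⊗ f` a
generated mono. -/
theorem Gen.graph_func [Finite W] [Finite P] {n : ℕ} (f : L.Functions n) {q : W → L.Term P}
    {ts ss : Fin n → L.Term W} (h : Gen q q (graph ts) (graph ss)) :
    Gen q q (graph fun _ : Fin 1 => Term.func f ts) (graph fun _ : Fin 1 => Term.func f ss) := by
  have hm := (Gen.verticalId (Term.var : W → L.Term W)).par (gen_oper_mono f)
  rw [par_var_var] at hm
  convert h.comp_mono hm using 1 <;>
  · funext i
    rcases i with i | i <;> simp [sub, graph, Th.par, oper, Term.relabel, Term.subst]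

theorem Gen.graph_congr {q : W → L.Term P} {t s : Z → L.Term W} {t' s' : Z' → L.Term W}
    (h : Gen q q (graph t) (graph s)) (e : Z ≃ Z') (ht : ∀ i, t' (e i) = t i)
    (hs : ∀ i, s' (e i) = s i) : Gen q q (graph t') (graph s') := by
  refine h.congr (Equiv.refl _) (Equiv.refl _) (Equiv.refl _) (Equiv.sumCongr (Equiv.refl _) e)
    (fun i => (Term.relabel_id _).symm) (fun i => (Term.relabel_id _).symm) ?_ ?_ <;>
  · rintro (i | i) <;> simp [graph, ht, hs]

/-- A set of variables split into one variable and the remaining ones. -/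
noncomputable def splitVar (x : W) : {y // ¬ y = x} ⊕ Fin 1 ≃ W := by
  classical
  exact (Equiv.sumComm _ _).trans ((Equiv.sumCongr (Equiv.ofUnique (Fin 1) {y // y = x})
      (Equiv.refl _)).trans (Equiv.sumCompl (· = x)))

theorem splitVar_inl (x : W) (y : {y // ¬ y = x}) : splitVar x (.inl y) = y := rfl

theorem splitVar_inr (x : W) (i : Fin 1) : splitVar x (.inr i) = x := rfl

/-- The graph of a variable duplicates `x` and fixes the rest, so `R_∇ ⊗ id` applies. -/
theorem gen_graph_var_mono [Finite W] (x : W) :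
    Gen Term.var Term.var (graph fun _ : Fin 1 => (Term.var x : L.Term W))
      (graph fun _ : Fin 1 => Term.var x) := by
  have h := (Gen.verticalId (Term.var : {y // ¬ y = x} → L.Term {y // ¬ y = x})).par
    (gen_dup_mono (L := L))
  refine h.congr (splitVar x) (splitVar x) (splitVar x) ((Equiv.sumAssoc _ _ _).symm.trans
    (Equiv.sumCongr (splitVar x) (Equiv.refl _))) ?_ ?_ ?_ ?_
  all_goals
    intro i
    rcases i with i | i <;> try rcases i with i | i
    all_goals simp [graph, par, splitVar_inl, splitVar_inr]

theorem gen_graph_mono_tuple [Finite W] {k : ℕ} {t : Fin k → L.Term W}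
    (h : ∀ i, Gen Term.var Term.var (graph fun _ : Fin 1 => t i) (graph fun _ : Fin 1 => t i)) :
    Gen Term.var Term.var (graph t) (graph t) := by
  induction k with
  | zero =>
    refine (Gen.verticalId Term.var).congr (Equiv.refl _) (Equiv.refl _) (Equiv.refl _)
      (Equiv.sumEmpty _ _).symm ?_ ?_ ?_ ?_ <;> intro i <;> simp [graph]
  | succ k ih =>
    have := Gen.pair (h (Fin.last k)) (t₁ := fun i : Fin k => t i.castSucc)
      (s₁ := fun i : Fin k => t i.castSucc)
      (by simpa only [var_sub] using ih fun i => h _)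
    refine this.graph_congr finSumFinEquiv ?_ ?_ <;>
    · rintro (i | i)
      · simp [Fin.castSucc]
      · obtain rfl := Subsingleton.elim i 0
        simp [Fin.last, Fin.natAdd]

theorem gen_graph_mono_term [Finite W] (t : L.Term W) :
    Gen Term.var Term.var (graph fun _ : Fin 1 => t) (graph fun _ : Fin 1 => t) := by
  induction t with
  | var x => exact gen_graph_var_mono x
  | func f ts ih => exact (gen_graph_mono_tuple ih).graph_func f

/-! ### Unification -/

/-- `q` is a most general unifier of `t` and `s`, and the corresponding square is generated. -/
structure IsMgu (t s : Z → L.Term W) (q : W → L.Term P) : Prop where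
  gen : Gen q q (graph t) (graph s)
  exists_factor : ∀ {V : Type} (c : W → L.Term V), sub c t = sub c s → ∃ d, c = sub d q

theorem IsMgu.symm {t s : Z → L.Term W} {q : W → L.Term P} (h : IsMgu t s q) : IsMgu s t q :=
  ⟨h.gen.transpose, fun c hc => h.exists_factor c hc.symm⟩

/-- Trivial equations also have to be realized by a generated square, which is the mono square of
the graph of `t`. -/
theorem isMgu_self [Finite W] {k : ℕ} (t : Fin k → L.Term W) : IsMgu t t Term.var :=
  ⟨gen_graph_mono_tuple fun _ => gen_graph_mono_term _, fun c _ => ⟨c, rfl⟩⟩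

theorem sub_assoc (a : X → L.Term P) (b : Y → L.Term X) (c : Z → L.Term Y) :
    sub (sub a b) c = sub a (sub b c) :=
  funext fun i => (subst_subst (c i) b a).symm

theorem IsMgu.pair [Finite V₁] [Finite V₂] [Finite W] [Finite Z₁] [Finite Z₂]
    {q₂ : W → L.Term V₂} {q₁ : V₂ → L.Term V₁} {t₁ s₁ : Z₁ → L.Term W} {t₂ s₂ : Z₂ → L.Term W}
    (h₂ : IsMgu t₂ s₂ q₂) (h₁ : IsMgu (sub q₂ t₁) (sub q₂ s₁) q₁) :
    IsMgu (Sum.elim t₁ t₂) (Sum.elim s₁ s₂) (sub q₁ q₂) := by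
  refine ⟨h₂.gen.pair h₁.gen, fun c hc => ?_⟩
  obtain ⟨d, rfl⟩ := h₂.exists_factor c (funext fun i => congrFun hc (.inr i))
  obtain ⟨e, rfl⟩ := h₁.exists_factor d (by
    rw [← sub_assoc, ← sub_assoc]
    exact funext fun i => congrFun hc (.inl i))
  exact ⟨e, sub_assoc _ _ _⟩

theorem IsMgu.congr {q : W → L.Term P} {t s : Z → L.Term W} {t' s' : Z' → L.Term W}
    (h : IsMgu t s q) (e : Z ≃ Z') (ht : ∀ i, t' (e i) = t i) (hs : ∀ i, s' (e i) = s i) :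
    IsMgu t' s' q :=
  ⟨h.gen.graph_congr e ht hs, fun c hc => h.exists_factor c <| funext fun i => by
    have := congrFun hc (e i)
    rwa [sub, sub, ht, hs] at this⟩

theorem IsMgu.func [Finite W] [Finite P] {n : ℕ} (f : L.Functions n) {q : W → L.Term P}
    {ts ss : Fin n → L.Term W} (h : IsMgu ts ss q) :
    IsMgu (fun _ : Fin 1 => Term.func f ts) (fun _ => Term.func f ss) q :=
  ⟨h.gen.graph_func f, fun c hc => h.exists_factor c <| by
    have := congrFun hc 0
    simp only [sub, Term.subst, Term.func.injEq, heq_eq_eq, true_and] at this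
    exact this⟩

/-- The number of operators in a term. -/
def termSize : L.Term V → ℕ
  | .var _ => 0
  | .func _ ts => 1 + ∑ i, termSize (ts i)

/-- The occurs check: if `x` occurs in `s`, then every instance of `s` contains the corresponding
instance of `x`, properly unless `s` is `x` itself. -/
theorem exists_relabel_or_termSize_le (x : W) (s : L.Term W) :
    (∃ s' : L.Term {y // ¬ y = x}, s = s'.relabel Subtype.val) ∨
      ∀ {V : Type} (c : W → L.Term V), termSize (c x) ≤ termSize (s.subst c) ∧
        (s ≠ Term.var x → termSize (c x) < termSize (s.subst c)) := by
  induction s with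
  | var y =>
    by_cases h : y = x
    · exact .inr fun c => ⟨by rw [h, Term.subst], fun h' => (h' (by rw [h])).elim⟩
    · exact .inl ⟨Term.var ⟨y, h⟩, rfl⟩
  | func f ts ih =>
    by_cases h : ∀ i, ∃ s' : L.Term {y // ¬ y = x}, ts i = s'.relabel Subtype.val
    · choose ss hs using h
      exact .inl ⟨Term.func f ss, by simp only [Term.relabel, ← hs]⟩
    · push Not at h
      obtain ⟨i, hi⟩ := h
      refine .inr fun c => ?_
      have h₁ := (((ih i).resolve_left fun ⟨s', h⟩ => hi s' h) c).1
      have h₂ := Finset.single_le_sum (f := fun i => termSize ((ts i).subst c))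
        (fun _ _ => Nat.zero_le _) (Finset.mem_univ i)
      have h₃ : termSize (c x) < termSize ((Term.func f ts).subst c) := by
        simp only [Term.subst, termSize]
        omega
      exact ⟨h₃.le, fun _ => h₃⟩

theorem exists_isMgu_var [Finite W] (x : W) (s : L.Term W) (hs : s ≠ Term.var x)
    (c : W → L.Term V) (hc : c x = s.subst c) :
    ∃ q : W → L.Term {y // ¬ y = x},
      IsMgu (fun _ : Fin 1 => Term.var x) (fun _ : Fin 1 => s) q := by
  classical
  obtain ⟨s', rfl⟩ | h := exists_relabel_or_termSize_le x s
  swap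
  · exact absurd (congrArg termSize hc) ((h c).2 hs).ne
  obtain ⟨q, hqx, hq⟩ : ∃ q : W → L.Term {y // ¬ y = x}, q x = s' ∧ ∀ y, q y.1 = Term.var y :=
    ⟨fun y => if h : y = x then s' else Term.var ⟨y, h⟩, by simp, fun y => by simp [y.2]⟩
  refine ⟨q, ?_, fun d hd => ⟨fun y => d y, ?_⟩⟩
  -- Take `a = ⟨id, s'⟩` and let `t` be the projection to `x`. Then `a ; t = s'`, so both
  -- projections are `⟨id, s'⟩`, and `a ⊗ id` becomes `⟨id, s⟩` after exchanging the last two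
  -- entries.
  · have := gen_graph (graph fun _ : Fin 1 => s') (fun _ : Fin 1 => (Term.var (.inr 0)))
    refine this.congr (Equiv.refl _) (splitVar x) (splitVar x)
      (((Equiv.sumAssoc _ _ _).trans (Equiv.sumCongr (Equiv.refl _) (Equiv.sumComm _ _))).trans
      ((Equiv.sumAssoc _ _ _).symm.trans (Equiv.sumCongr (splitVar x) (Equiv.refl _))))
      ?_ ?_ ?_ ?_
    all_goals
      intro i
      rcases i with i | i <;> try rcases i with i | i
      all_goals simp [graph, par, sub, splitVar_inl, splitVar_inr, hqx, hq, Function.comp_def]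
  · funext y
    by_cases h : y = x
    · have := congrFun hd 0
      simp only [sub, Term.subst, subst_relabel] at this
      rw [sub, h, hqx, this]
    · rw [sub, hq ⟨y, h⟩, Term.subst]

/-- The statement that two unifiable tuples have a most general unifier, which eliminates a
variable unless the tuples are equal. -/
def HasMgu (t s : Z → L.Term W) : Prop :=
  ∀ (V : Type) (c : W → L.Term V), sub c t = sub c s →
    ∃ (P : Type) (_ : Finite P) (q : W → L.Term P),
      IsMgu t s q ∧ (Nat.card P < Nat.card W ∨ t = s)

/-- The last entries are unified first. Either this eliminates a variable, and `hW` solves the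
instantiated remainder, or they already coincide and the shorter tuple over the same variables
remains. -/
theorem hasMgu_tuple [Finite W]
    (hW : ∀ (W' : Type) [Finite W'], Nat.card W' < Nat.card W →
      ∀ (k : ℕ) (t s : Fin k → L.Term W'), HasMgu t s)
    {k : ℕ} (t s : Fin k → L.Term W)
    (h : ∀ i, HasMgu (fun _ : Fin 1 => t i) (fun _ : Fin 1 => s i)) : HasMgu t s := by
  induction k with
  | zero =>
    obtain rfl := Subsingleton.elim t s
    exact fun _ _ _ => ⟨W, ‹_›, _, isMgu_self t, .inr rfl⟩
  | succ k ih =>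
    intro V c hc
    suffices ∃ (P : Type) (_ : Finite P) (q : W → L.Term P),
        IsMgu (Sum.elim (fun i : Fin k => t i.castSucc) (fun _ : Fin 1 => t (Fin.last k)))
          (Sum.elim (fun i : Fin k => s i.castSucc) (fun _ : Fin 1 => s (Fin.last k))) q ∧
        (Nat.card P < Nat.card W ∨ t = s) by
      obtain ⟨P, hP, q, hq, h'⟩ := this
      refine ⟨P, hP, q, hq.congr finSumFinEquiv ?_ ?_, h'⟩ <;>
      · rintro (i | i)
        · simp [Fin.castSucc]
        · obtain rfl := Subsingleton.elim i 0
          simp [Fin.last, Fin.natAdd]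
    obtain ⟨P₂, _, q₂, hq₂, h₂⟩ := h (Fin.last k) V c (funext fun _ => congrFun hc _)
    rcases h₂ with h₂ | h₂
    -- The given unifier factors through `q₂`, and the remaining factor `d` unifies the instantiated
    -- entries.
    · obtain ⟨d, rfl⟩ := hq₂.exists_factor c (funext fun _ => congrFun hc _)
      obtain ⟨P₁, _, q₁, hq₁, h₁⟩ := hW P₂ h₂ k (sub q₂ fun i => t i.castSucc)
        (sub q₂ fun i => s i.castSucc) V d (by
          rw [← sub_assoc, ← sub_assoc]
          exact funext fun i => congrFun hc _)
      rcases h₁ with h₁ | h₁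
      · exact ⟨P₁, ‹_›, _, hq₂.pair hq₁, .inl (h₁.trans h₂)⟩
      -- Nothing bounds the size of `P₁` here, so `q₁` is replaced by the identity in order to keep
      -- the bound on `P₂`.
      · exact ⟨P₂, ‹_›, _, hq₂.pair (by rw [h₁]; exact isMgu_self _), .inl h₂⟩
    · obtain ⟨P₁, _, q₁, hq₁, h₁⟩ := ih (fun i => t i.castSucc) (fun i => s i.castSucc)
        (fun i => h _) V c (funext fun i => congrFun hc _)
      rw [← h₂]
      refine ⟨P₁, ‹_›, _, (isMgu_self _).pair (q₁ := q₁) (by rwa [var_sub, var_sub]),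
        h₁.imp_right fun h₁ => funext fun i => ?_⟩
      refine Fin.lastCases (congrFun h₂ 0) (fun i => congrFun h₁ i) i

theorem hasMgu_term [Finite W]
    (hW : ∀ (W' : Type) [Finite W'], Nat.card W' < Nat.card W →
      ∀ (k : ℕ) (t s : Fin k → L.Term W'), HasMgu t s) (t s : L.Term W) :
    HasMgu (fun _ : Fin 1 => t) (fun _ : Fin 1 => s) := by
  by_cases hts : t = s
  · rw [hts]
    exact fun _ _ _ => ⟨W, ‹_›, _, isMgu_self _, .inr rfl⟩
  have hcard (x : W) : Nat.card {y // ¬ y = x} < Nat.card W :=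
    Finite.card_subtype_lt (x := x) (by simp)
  induction t generalizing s with
  | var x =>
    intro V c hc
    obtain ⟨q, hq⟩ := exists_isMgu_var x s (Ne.symm hts) c (congrFun hc 0)
    exact ⟨_, inferInstance, q, hq, .inl (hcard x)⟩
  | func f ts ih =>
    intro V c hc
    cases s with
    | var x =>
      obtain ⟨q, hq⟩ := exists_isMgu_var x _ hts c (congrFun hc 0).symm
      exact ⟨_, inferInstance, q, hq.symm, .inl (hcard x)⟩
    | @func m g ss =>
      -- Substitution preserves the head operator, so unifiability excludes a clash and passes to
      -- the arguments.
      have hc₀ := congrFun hc 0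
      simp only [sub, Term.subst, Term.func.injEq] at hc₀
      obtain ⟨rfl, hfg, hc₁⟩ := hc₀
      obtain rfl := eq_of_heq hfg
      obtain ⟨P, hP, q, hq, h⟩ := hasMgu_tuple hW ts ss (fun i => by
        by_cases hi : ts i = ss i
        · rw [hi]
          exact fun _ _ _ => ⟨W, ‹_›, _, isMgu_self _, .inr rfl⟩
        · exact ih i _ hi) V c (eq_of_heq hc₁)
      exact ⟨P, hP, q, hq.func f, h.imp_right fun h => by rw [h]⟩

theorem hasMgu (W : Type) [Finite W] (k : ℕ) (t s : Fin k → L.Term W) : HasMgu t s := by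
  obtain ⟨N, hN⟩ : ∃ N, Nat.card W = N := ⟨_, rfl⟩
  induction N using Nat.strong_induction_on generalizing W k with
  | _ N ih =>
    have hW : ∀ (W' : Type) [Finite W'], Nat.card W' < Nat.card W →
        ∀ (k : ℕ) (t s : Fin k → L.Term W'), HasMgu t s :=
      fun W' _ h k t s => ih _ (hN ▸ h) W' k t s rfl
    exact hasMgu_tuple hW t s fun i => hasMgu_term hW _ _

/-! ### From unifiers to squares over a cospan -/

/-- The square of projections from `X ⊗ Y ⊗ Z`. -/
theorem gen_proj [Finite X] [Finite Y] [Finite Z] :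
    Gen (P := (X ⊕ Y) ⊕ Z) (X := X ⊕ Z) (Y := Y ⊕ Z) (Z := Z)
      (par (fun i => (Term.var (.inl i) : L.Term (X ⊕ Y))) Term.var)
      (par (fun i => Term.var (.inr i)) Term.var) (fun i => Term.var (.inr i))
      (fun i => Term.var (.inr i)) := by
  let bang (A : Type) : Fin 0 → L.Term A := Fin.elim0
  -- The product of `X` and `Y` is the pullback over the terminal object `0`, a tensor of two
  -- identity squares; it is then tensored with `Z`.
  have h := ((Gen.verticalId (bang X)).par (Gen.horizontalId (bang Y))).par
    (Gen.horizontalId (Term.var : Z → L.Term Z))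
  refine h.congr (Equiv.refl _) (Equiv.sumCongr (Equiv.sumEmpty _ _) (Equiv.refl _))
    (Equiv.sumCongr (Equiv.emptySum _ _) (Equiv.refl _))
    ((Equiv.sumCongr (Equiv.sumEmpty _ _) (Equiv.refl _)).trans (Equiv.emptySum _ _)) ?_ ?_ ?_ ?_
  · rintro ((i | i) | i)
    · rfl
    · exact i.elim0
    · rfl
  · rintro ((i | i) | i)
    · exact i.elim0
    · rfl
    · rfl
  · rintro ((i | i) | i)
    · exact i.elim0
    · exact i.elim0
    · rfl
  · rintro ((i | i) | i)
    · exact i.elim0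
    · exact i.elim0
    · rfl

theorem exists_gen [Finite X] [Finite Y] {k : ℕ} (h : Fin k → L.Term X) (g : Fin k → L.Term Y)
    (a : X → L.Term V) (b : Y → L.Term V) (hab : sub a h = sub b g) :
    ∃ (P : Type) (_ : Finite P) (t : X → L.Term P) (u : Y → L.Term P), Gen t u h g := by
  obtain ⟨P, hP, q, hq, -⟩ := hasMgu (X ⊕ Y) k
    (sub (fun i => Term.var (.inl i)) h) (sub (fun i => Term.var (.inr i)) g) V (Sum.elim a b)
    (by rw [← sub_assoc, ← sub_assoc]; exact hab)
  -- The same grid as in `Gen.pair`: the `gen_graph` squares replace the graphs over `X ⊕ Y` by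
  -- those of `h` and `g`, and `gen_proj` projects the graphs to their values.
  have := (hq.gen.hcomp (gen_graph _ h)).vcomp ((gen_graph _ g).transpose.hcomp gen_proj)
  exact ⟨P, hP, _, _, this⟩

end

end Th

/-! ### Soundness: generated squares are pullbacks -/

namespace CategoryTheory.IsPullback

theorem of_exists_lift {C : Type u} [Category.{v} C] {P X Y Z : C} {t : P ⟶ X} {u : P ⟶ Y}
    {v : X ⟶ Z} {s : Y ⟶ Z} (w : t ≫ v = u ≫ s)
    (exists_lift : ∀ {W : C} (a : W ⟶ X) (b : W ⟶ Y), a ≫ v = b ≫ s → ∃ l, l ≫ t = a ∧ l ≫ u = b)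
    (uniq : ∀ {W : C} (l l' : W ⟶ P), l ≫ t = l' ≫ t → l ≫ u = l' ≫ u → l = l') :
    IsPullback t u v s := by
  choose l h₁ h₂ using @exists_lift
  exact ⟨⟨w⟩, ⟨Limits.PullbackCone.IsLimit.mk w (fun c => l c.fst c.snd c.condition)
    (fun c => h₁ _ _ _) (fun c => h₂ _ _ _) fun c m hm₁ hm₂ =>
      uniq _ _ (hm₁.trans (h₁ _ _ _).symm) (hm₂.trans (h₂ _ _ _).symm)⟩⟩

end CategoryTheory.IsPullback

namespace Th

open FirstOrder Language

variable {L : FirstOrder.Language.{u, v}}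

theorem comp_tensor_left {W m n k l : Th L} (a : W ⟶ m ⊗ k) (σ : m ⟶ n) (τ : k ⟶ l)
    (i : Fin n.card) : (a ≫ (σ ⊗ₘ τ)) (Fin.castAdd l.card i) =
      (σ i).subst fun j => a (Fin.castAdd k.card j) := by
  rw [comp_apply, tensor_left, subst_relabel]

theorem comp_tensor_right {W m n k l : Th L} (a : W ⟶ m ⊗ k) (σ : m ⟶ n) (τ : k ⟶ l)
    (i : Fin l.card) : (a ≫ (σ ⊗ₘ τ)) (Fin.natAdd n.card i) =
      (τ i).subst fun j => a (Fin.natAdd m.card j) := by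
  rw [comp_apply, tensor_right, subst_relabel]

theorem isPullback_tensor {P X Y Z P' X' Y' Z' : Th L} {t : P ⟶ X} {u : P ⟶ Y} {v : X ⟶ Z}
    {s : Y ⟶ Z} {t' : P' ⟶ X'} {u' : P' ⟶ Y'} {v' : X' ⟶ Z'} {s' : Y' ⟶ Z'}
    (h : IsPullback t u v s) (h' : IsPullback t' u' v' s') :
    IsPullback (t ⊗ₘ t') (u ⊗ₘ u') (v ⊗ₘ v') (s ⊗ₘ s') := by
  refine IsPullback.of_exists_lift ?_ (fun {W} a b hab => ?_) (fun {W} l l' h₁ h₂ => ?_)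
  · rw [tensor_comp_tensor, tensor_comp_tensor, h.w, h'.w]
  · let a₁ : W ⟶ X := fun j => a (Fin.castAdd X'.card j)
    let a₂ : W ⟶ X' := fun j => a (Fin.natAdd X.card j)
    let b₁ : W ⟶ Y := fun j => b (Fin.castAdd Y'.card j)
    let b₂ : W ⟶ Y' := fun j => b (Fin.natAdd Y.card j)
    have e₁ : a₁ ≫ v = b₁ ≫ s := hom_ext fun i => by
      have := congrFun hab (Fin.castAdd Z'.card i)
      rwa [comp_tensor_left, comp_tensor_left] at this
    have e₂ : a₂ ≫ v' = b₂ ≫ s' := hom_ext fun i => by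
      have := congrFun hab (Fin.natAdd Z.card i)
      rwa [comp_tensor_right, comp_tensor_right] at this
    refine ⟨dup W ≫ (h.lift a₁ b₁ e₁ ⊗ₘ h'.lift a₂ b₂ e₂), ?_, ?_⟩
    · rw [Category.assoc, tensor_comp_tensor, h.lift_fst, h'.lift_fst]
      exact hom_ext_tensor (fun i => dup_comp_tensor_left _ _ i)
        (fun i => dup_comp_tensor_right _ _ i)
    · rw [Category.assoc, tensor_comp_tensor, h.lift_snd, h'.lift_snd]
      exact hom_ext_tensor (fun i => dup_comp_tensor_left _ _ i)
        (fun i => dup_comp_tensor_right _ _ i)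
  · have e₁ : (fun j => l (Fin.castAdd P'.card j) : W ⟶ P) = fun j => l' (Fin.castAdd P'.card j) :=
      h.hom_ext
        (hom_ext fun i => by
          have := congrFun h₁ (Fin.castAdd X'.card i)
          rwa [comp_tensor_left, comp_tensor_left] at this)
        (hom_ext fun i => by
          have := congrFun h₂ (Fin.castAdd Y'.card i)
          rwa [comp_tensor_left, comp_tensor_left] at this)
    have e₂ : (fun j => l (Fin.natAdd P.card j) : W ⟶ P') = fun j => l' (Fin.natAdd P.card j) :=
      h'.hom_ext
        (hom_ext fun i => by
          have := congrFun h₁ (Fin.natAdd X.card i)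
          rwa [comp_tensor_right, comp_tensor_right] at this)
        (hom_ext fun i => by
          have := congrFun h₂ (Fin.natAdd Y.card i)
          rwa [comp_tensor_right, comp_tensor_right] at this)
    exact hom_ext_tensor (fun i => congrFun e₁ i) (fun i => congrFun e₂ i)

instance mono_oper {n : ℕ} (f : L.Functions n) : Mono (oper f) where
  right_cancellation l l' h := by
    have := congrFun h 0
    simp only [comp_apply, oper, Term.subst, Term.func.injEq, heq_eq_eq, true_and] at this
    exact this

theorem comp_dup_left {m n : Th L} (a : m ⟶ n) (i : Fin n.card) :
    (a ≫ dup n) (Fin.castAdd n.card i) = a i := by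
  simp only [comp_apply, dup, Fin.append_left, Term.subst]

theorem comp_dup_right {m n : Th L} (a : m ⟶ n) (i : Fin n.card) :
    (a ≫ dup n) (Fin.natAdd n.card i) = a i := by
  simp only [comp_apply, dup, Fin.append_right, Term.subst]

instance mono_dup (n : Th L) : Mono (dup n) where
  right_cancellation l l' h := hom_ext fun i => by
    have := congrFun h (Fin.castAdd n.card i)
    rwa [comp_dup_left, comp_dup_left] at this

instance mono_symm (n m : Th L) : Mono (symm n m) where
  right_cancellation l l' h := hom_ext_tensor
    (fun i => by
      have := congrFun h (Fin.natAdd m.card i)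
      simp only [comp_apply, symm, Fin.append_right] at this
      exact this)
    (fun i => by
      have := congrFun h (Fin.castAdd n.card i)
      simp only [comp_apply, symm, Fin.append_left] at this
      exact this)

/-- For `y = (y₁, y₂)`, the equation `(x, x) = (y₁ ; a, y₂)` says that `y₁` determines both `x` and
`y₂`, so `y₁` is the lift. -/
theorem isPullback_dup {n m : Th L} (a : n ⟶ m) :
    IsPullback a (dup n ≫ (𝟙 n ⊗ₘ a)) (dup m) (a ⊗ₘ 𝟙 m) := by
  refine IsPullback.of_exists_lift ?_ (fun {W} x y h => ?_) (fun {W} l l' h₁ h₂ => ?_)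
  · rw [Category.assoc, tensor_comp_tensor, Category.id_comp, Category.comp_id]
    refine hom_ext_tensor (fun i => ?_) (fun i => ?_)
    · rw [comp_dup_left, dup_comp_tensor_left]
    · rw [comp_dup_right, dup_comp_tensor_right]
  · have e₁ (i) : x i = (a i).subst fun j => y (Fin.castAdd m.card j) := by
      have := congrFun h (Fin.castAdd m.card i)
      rwa [comp_dup_left, comp_tensor_left] at this
    have e₂ (i) : x i = y (Fin.natAdd n.card i) := by
      have := congrFun h (Fin.natAdd m.card i)
      rwa [comp_dup_right, comp_tensor_right] at this
    refine ⟨fun j => y (Fin.castAdd m.card j), hom_ext fun i => (e₁ i).symm,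
      hom_ext_tensor (fun i => ?_) (fun i => ?_)⟩
    · rw [comp_apply, dup_comp_tensor_left]
      rfl
    · rw [comp_apply, dup_comp_tensor_right, ← e₁, e₂]
  · refine hom_ext fun i => ?_
    have := congrFun h₂ (Fin.castAdd m.card i)
    rw [comp_apply l, comp_apply l', dup_comp_tensor_left] at this
    exact this

theorem isPullback_dupD : IsPullback (dup (one L)) (dup (one L))
    ((𝟙 (one L) ⊗ₘ dup (one L)) ≫ (α_ (one L) (one L) (one L)).inv)
    (dup (one L) ⊗ₘ 𝟙 (one L)) := by
  refine IsPullback.of_exists_lift (hom_ext fun i => ?_) (fun {W} x y h => ?_)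
    (fun {W} l l' h₁ h₂ => (cancel_mono (dup (one L))).1 h₁)
  · change Fin 3 at i
    fin_cases i <;> rfl
  · have h₀ : x (0 : Fin 2) = y (0 : Fin 2) := congrFun h (0 : Fin 3)
    have h₁ : x (1 : Fin 2) = y (0 : Fin 2) := congrFun h (1 : Fin 3)
    have h₂ : x (1 : Fin 2) = y (1 : Fin 2) := congrFun h (2 : Fin 3)
    refine ⟨fun _ => y (0 : Fin 2), hom_ext fun i => ?_, hom_ext fun i => ?_⟩
    · change Fin 2 at i
      fin_cases i
      · exact h₀.symm
      · exact h₁.symm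
    · change Fin 2 at i
      fin_cases i
      · rfl
      · exact h₁.symm.trans h₂

theorem isPullback_basis (b : BasisName L) : IsPullback (basisCell L b).t (basisCell L b).u
    (basisCell L b).v (basisCell L b).s := by
  cases b with
  | opR f => exact IsKernelPair.id_of_mono (oper f)
  | opD f => exact isPullback_dup (oper f)
  | opDHat f => exact (isPullback_dup (oper f)).flip
  | dupR => exact IsKernelPair.id_of_mono (dup (one L))
  | symmR => exact IsKernelPair.id_of_mono (symm (one L) (one L))
  | dupD => exact isPullback_dupD

theorem isPullback_of_entails {P X Y Z : Th L} {t : P ⟶ X} {u : P ⟶ Y} {v : X ⟶ Z} {s : Y ⟶ Z}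
    (h : (basisTiles L).Entails t u v s) : IsPullback t u v s := by
  induction h with
  | basic b => exact isPullback_basis b
  | horizontalId t => exact (pullbackDoubleCategory (Th L)).horizontalId t
  | verticalId t => exact (pullbackDoubleCategory (Th L)).verticalId t
  | horizontalComp _ _ h h' => exact h.paste_horiz h'
  | verticalComp _ _ h h' => exact h.paste_vert h'
  | parallelComp _ _ h h' => exact isPullback_tensor h h'

/-! ### Completeness: pullbacks are generated -/

theorem exists_var_of_comp_eq_id {m n : Th L} (σ : m ⟶ n) (τ : n ⟶ m) (h : τ ≫ σ = 𝟙 n)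
    (i : Fin n.card) : ∃ j, σ i = Term.var j := by
  have := congrFun h i
  rw [comp_apply, id_apply] at this
  cases hσ : σ i with
  | var j => exact ⟨j, rfl⟩
  | func f ts => rw [hσ, Term.subst] at this; cases this

/-- No substitution turns a term headed by an operator into a variable, so both directions consist
of variables, and the two index maps are mutually inverse. -/
theorem exists_eq_permIso {m n : Th L} (φ : m ≅ n) :
    ∃ e : Fin n.card ≃ Fin m.card, φ = permIso e := by
  choose f hf using fun i => exists_var_of_comp_eq_id φ.hom φ.inv φ.inv_hom_id i
  choose g hg using fun i => exists_var_of_comp_eq_id φ.inv φ.hom φ.hom_inv_id i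
  refine ⟨⟨f, g, fun i => ?_, fun i => ?_⟩, Iso.ext (hom_ext hf)⟩
  · have := congrFun φ.inv_hom_id i
    rw [comp_apply, hf, Term.subst, hg] at this
    exact Term.var.inj this
  · have := congrFun φ.hom_inv_id i
    rw [comp_apply, hg, Term.subst, hf] at this
    exact Term.var.inj this

theorem generated_of_isPullback {P X Y Z : Th L} {t : P ⟶ X} {u : P ⟶ Y} {v : X ⟶ Z} {s : Y ⟶ Z}
    (h : IsPullback t u v s) : Generated L t u v s := by
  obtain ⟨Q, _, t', u', h'⟩ := exists_gen v s t u h.w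
  obtain ⟨n, ⟨e⟩⟩ := Finite.exists_equiv_fin Q
  have h₁ := h'.generated e.symm (Equiv.refl _) (Equiv.refl _) (Equiv.refl _)
  replace h₁ : Generated L (P := ⟨n⟩) (X := X) (Y := Y) (Z := Z) _ _ v s :=
    h₁.of_eq rfl rfl (hom_ext fun i => Term.relabel_id _) (hom_ext fun i => Term.relabel_id _)
  -- Soundness supplies the universal property of the constructed square, and hence the comparison
  -- isomorphism with `P`.
  have h₂ := isPullback_of_entails h₁
  obtain ⟨f, hf⟩ := exists_eq_permIso (h.isoIsPullback _ _ h₂)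
  have h₃ := TileSystem.Entails.conj h₁ (h.isoIsPullback _ _ h₂) (Iso.refl X) (Iso.refl Y)
    (Iso.refl Z) (by rw [hf]; exact monoTile_permIso f.symm) (TileSystem.MonoTile.id _)
    (TileSystem.MonoTile.id _) (TileSystem.MonoTile.id _)
  refine Generated.of_eq h₃ ?_ ?_ ?_ ?_ <;> simp

/-! ### Tiles in the opposite category, and finiteness of the basis -/

theorem generated_unop {o₀ o₁ o₂ o₃ : (Th L)ᵒᵖ} {t : o₀ ⟶ o₁} {u : o₀ ⟶ o₂} {v : o₁ ⟶ o₃}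
    {s : o₂ ⟶ o₃} (h : (pullbackTiles L).Entails t u v s) :
    (basisTiles L).Entails s.unop v.unop u.unop t.unop := by
  induction h with
  | basic b =>
    cases b with
    | opR f => exact generated_basis (.opR f)
    | opD f => exact generated_basis (.opD f)
    | opDHat f => exact generated_basis (.opDHat f)
    | dupR => exact generated_basis .dupR
    | symmR => exact generated_basis .symmR
    | dupD => exact generated_basis .dupD
  | horizontalId t => exact .horizontalId t.unop
  | verticalId t => exact .verticalId t.unop
  | horizontalComp _ _ h h' => exact h'.horizontalComp h
  | verticalComp _ _ h h' => exact h'.verticalComp h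
  | parallelComp _ _ h h' => exact h.parallelComp h'

theorem entails_op {P X Y Z : Th L} {t : P ⟶ X} {u : P ⟶ Y} {v : X ⟶ Z} {s : Y ⟶ Z}
    (h : (basisTiles L).Entails t u v s) :
    (pullbackTiles L).Entails s.op v.op u.op t.op := by
  induction h with
  | basic b =>
    cases b with
    | opR f => exact .basic (R := pullbackTiles L) (BasisName.opR f)
    | opD f => exact .basic (R := pullbackTiles L) (BasisName.opD f)
    | opDHat f => exact .basic (R := pullbackTiles L) (BasisName.opDHat f)
    | dupR => exact .basic (R := pullbackTiles L) (BasisName.dupR)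
    | symmR => exact .basic (R := pullbackTiles L) (BasisName.symmR)
    | dupD => exact .basic (R := pullbackTiles L) (BasisName.dupD)
  | horizontalId t => exact .horizontalId t.op
  | verticalId t => exact .verticalId t.op
  | horizontalComp _ _ h h' => exact h'.horizontalComp h
  | verticalComp _ _ h h' => exact h'.verticalComp h
  | parallelComp _ _ h h' => exact h.parallelComp h'

instance finite_basisName [Finite (Σ n, L.Functions n)] : Finite (BasisName L) := by
  let F : (Σ n, L.Functions n) ⊕ (Σ n, L.Functions n) ⊕ (Σ n, L.Functions n) ⊕ Fin 3 →
      BasisName L :=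
    Sum.elim (fun f => .opR f.2) (Sum.elim (fun f => .opD f.2) (Sum.elim (fun f => .opDHat f.2)
      ![.dupR, .symmR, .dupD]))
  refine Finite.of_surjective F fun b => ?_
  cases b with
  | opR f => exact ⟨.inl ⟨_, f⟩, rfl⟩
  | opD f => exact ⟨.inr (.inl ⟨_, f⟩), rfl⟩
  | opDHat f => exact ⟨.inr (.inr (.inl ⟨_, f⟩)), rfl⟩
  | dupR => exact ⟨.inr (.inr (.inr 0)), rfl⟩
  | symmR => exact ⟨.inr (.inr (.inr 1)), rfl⟩
  | dupD => exact ⟨.inr (.inr (.inr 2)), rfl⟩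

end Th

theorem mainTheorem1 (L : FirstOrder.Language.{u, v}) :
    (∀ {P X Y Z : Th L} (p₀ : P ⟶ X) (p₁ : P ⟶ Y) (h : X ⟶ Z) (g : Y ⟶ Z),
      Th.Generated L p₀ p₁ h g ↔ IsPullback p₀ p₁ h g) ∧
    (∀ {o₀ o₁ o₂ o₃ : (Th L)ᵒᵖ} (t : o₀ ⟶ o₁) (u : o₀ ⟶ o₂) (v : o₁ ⟶ o₃) (s : o₂ ⟶ o₃),
      (Th.pullbackTiles L).Entails t u v s ↔
        (pullbackDoubleCategory (Th L)).IsCell s.unop v.unop u.unop t.unop) ∧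
    (Finite (Σ n, L.Functions n) → (Set.range (Th.basisCell L)).Finite) := by
  refine ⟨fun p₀ p₁ h g => ⟨Th.isPullback_of_entails, Th.generated_of_isPullback⟩,
    fun t u v s => ⟨fun h => Th.isPullback_of_entails (Th.generated_unop h),
      fun h => Th.entails_op (Th.generated_of_isPullback h)⟩, fun _ => Set.finite_range _⟩
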